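/- Let $L_1,L_2,L_3>0$. For $q:\mathbb R^d\to\mathbb R$ say that $q$ is $r$th-order smooth with constant $L_r$ if it is $r$ times differentiable and $|\nabla^r q(x)[s]^r-\nabla^r q(y)[s]^r|\le L_r\|x-y\|$ for all $x,y,s\in\mathbb R^d$ with $\|s\|\le1$, where $\nabla^r q(x)[s]^r=\sum_{i_1,\dots,i_r}\frac{\partial^r q(x)}{\partial x_{i_1}\cdots\partial x_{i_r}}s_{i_1}\cdots s_{i_r}$. Let $f:\mathbb R^d\to\mathbb R$ be convex, three times continuously differentiable, and first-, second- and third-order smooth with constants $L_1,L_2,L_3$. For $\lambda>0$ put $$f_\lambda(x)=\mathbb E_{u\sim\mathcal N(0,I_d)}[f(x+\lambda u)],\qquad F(x)=f(x)+\tfrac{\lambda^2}{2}\operatorname{tr}(\nabla^2 f(x)),\qquad g_\lambda(x,u)=\frac{f(x+\lambda u)-f(x-\lambda u)}{2\lambda}\,u .$$ Given $x_0\in\mathbb R^d$ and independent $u_0,u_1,\ldots\sim\mathcal N(0,I_d)$, let $x_{t+1}=x_t-\eta\,g_\lambda(x_t,u_t)$ with stepsize $\eta=\frac{1}{8(d+2)L_1}$,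 and $\bar x_T=\frac1T\sum_{t=0}^{T-1}x_t$ for $T\ge1$. Assume that $f_\lambda$ has a minimizer, and let $x_\lambda^*\in\arg\min f_\lambda$ be any one. **(1)** For every $\lambda>0$ and $T\ge 1$, $F$ is bounded below, $F(\bar x_T)$ is integrable, and $$\mathbb E\Big[F(\bar x_T)-\inf_{x\in\mathbb R^d}F(x)\Big]\le\frac{8(d+2)L_1\|x_0-x_\lambda^*\|^2}{T}+\frac{L_2^2}{12L_1}\lambda^4(d+8)^4+\frac{L_3}{12}\lambda^4(d+4)^2 .$$ **(2)** Assume in addition that $\mathcal X^*=\arg\min f$ is nonempty. Let $\epsilon>0$, let $\lambda>0$ satisfy $$\lambda^2=\min\Big\{\frac{2\epsilon}{L_3(d+4)^2},\frac{2L_1\epsilon}{L_2^2(d+8)^4}\Big\},$$ and let $T\ge1$ be an integer with $$T\ge\frac{48(d+2)L_1\|x_0-x_\lambda^*\|^2}{\epsilon}\max\Big\{\frac{L_3(d+4)^2}{2\epsilon},\frac{L_2^2(d+8)^4}{2L_1\epsilon}\Big\}.$$ Then $f(\bar x_T)$ and $\operatorname{tr}(\nabla^2f(\bar x_T))$ are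 integrable, and $$\mathbb E\Big[f(\bar x_T)-\min_{x\in\mathbb R^d}f(x)\Big]\le\frac{L_1^2\epsilon}{L_2^2(d+8)^3}\Big(1+\frac{\epsilon}{L_1(d+8)}\Big),\qquad \mathbb E\Big[\operatorname{tr}(\nabla^2f(\bar x_T))-\inf_{x\in\mathcal X^*}\operatorname{tr}(\nabla^2f(x))\Big]\le\epsilon .$$ **(3)** Consequently $(O(\epsilon/d^3),\epsilon)$-approximate flat minima are obtained in expectation with $T=O(d^5/\epsilon^2)$ and $\lambda=O(\epsilon^{1/2}/d^2)$. Precisely: for all $R,\epsilon_0$ there is a constant $C>0$ depending only on $L_1,L_2,L_3,R,\epsilon_0$ such that for all $d\ge1$, all $f$ as above with $\mathcal X^*\ne\emptyset$, all $\epsilon\in(0,\epsilon_0]$, $\lambda$ as in (2), and all $x_0$, $x_\lambda^*$ with $\|x_0-x_\lambda^*\|\le R$: $\lambda\le C\epsilon^{1/2}/d^2$, and there is an integer $1\le T\le C d^5/\epsilon^2$ for which $f(\bar x_T)$ and $\operatorname{tr}(\nabla^2f(\bar x_T))$ are integrable with $$\mathbb E\Big[f(\bar x_T)-\min_{x\in\mathbb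 R^d}f(x)\Big]\le\frac{C\epsilon}{d^3},\qquad \mathbb E\Big[\operatorname{tr}(\nabla^2f(\bar x_T))-\inf_{x\in\mathcal X^*}\operatorname{tr}(\nabla^2f(x))\Big]\le\epsilon .$$ -/

import Mathlib

open MeasureTheory ProbabilityTheory

noncomputable section

namespace FlatMinima

/-- Euclidean space of dimension `d`. -/
abbrev E (d : ℕ) : Type := EuclideanSpace ℝ (Fin d)

/-- The set of global minimizers of `f`. -/
def argmin {d : ℕ} (f : E d → ℝ) : Set (E d) :=
  {x | ∀ y, f x ≤ f y}

/-- `q` is `r`th-order smooth with constant `L`: it is `r` times differentiable and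
`‖∇ʳ q(x) - ∇ʳ q(y)‖ ≤ L ‖x - y‖` for all `x, y`, where the norm of a symmetric `r`-tensor `A`
is the maximum of `|A[s]ʳ|` over `‖s‖ ≤ 1` (so a bound on the norm is the bound for all such `s`).
Differentiability is recorded in the class `C^r`, which any `r` times differentiable function
with Lipschitz `r`th derivative belongs to. -/
def SmoothOfOrder {d : ℕ} (r : ℕ) (L : ℝ) (q : E d → ℝ) : Prop :=
  ContDiff ℝ r q ∧
    ∀ x y s : E d, ‖s‖ ≤ 1 →
      |iteratedFDeriv ℝ r q x (fun _ => s) - iteratedFDeriv ℝ r q y (fun _ => s)| ≤ L * ‖x - y‖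

/-- The smoothness assumption: three times continuously differentiable, and first-, second- and
third-order smooth with constants `L₁`, `L₂`, `L₃`. -/
structure SmoothnessAssumption {d : ℕ} (L₁ L₂ L₃ : ℝ) (f : E d → ℝ) : Prop where
  contDiff : ContDiff ℝ 3 f
  first : SmoothOfOrder 1 L₁ f
  second : SmoothOfOrder 2 L₂ f
  third : SmoothOfOrder 3 L₃ f

/-- The Hessian matrix of second-order partial derivatives. -/
def hessian {d : ℕ} (f : E d → ℝ) (x : E d) : Matrix (Fin d) (Fin d) ℝ :=
  Matrix.of fun i j =>
    iteratedFDeriv ℝ 2 f x ![EuclideanSpace.single i (1 : ℝ), EuclideanSpace.single j (1 : ℝ)]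

/-- The trace of the Hessian. -/
def trHess {d : ℕ} (f : E d → ℝ) (x : E d) : ℝ :=
  (hessian f x).trace

/-- The smoothed function `f_λ(x) = 𝔼 f(x + λ u)`, with `u` standard Gaussian. -/
def smoothed {d : ℕ} (f : E d → ℝ) (lam : ℝ) (x : E d) : ℝ :=
  ∫ u, f (x + lam • u) ∂(stdGaussian (E d))

/-- The regularized loss `F(x) = f(x) + (λ² / 2) tr(∇² f(x))`. -/
def regLoss {d : ℕ} (f : E d → ℝ) (lam : ℝ) (x : E d) : ℝ :=
  f x + lam ^ 2 / 2 * trHess f x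

/-- The two-point gradient estimator `g_λ(x, u)`. -/
def twoPoint {d : ℕ} (f : E d → ℝ) (lam : ℝ) (x u : E d) : E d :=
  ((f (x + lam • u) - f (x - lam • u)) / (2 * lam)) • u

/-- The iterates of zeroth-order optimization with initialization `x₀`, stepsize `η`, smoothing
parameter `lam` and search directions `u 0, u 1, …`. -/
def iterate {d : ℕ} (f : E d → ℝ) (η lam : ℝ) (x₀ : E d) (u : ℕ → E d) : ℕ → E d
  | 0 => x₀
  | t + 1 => iterate f η lam x₀ u t - η • twoPoint f lam (iterate f η lam x₀ u t) (u t)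

/-- The average `(1 / T) ∑_{t < T} x_t` of the first `T` iterates. -/
def avgIterate {d : ℕ} (f : E d → ℝ) (η lam : ℝ) (x₀ : E d) (u : ℕ → E d) (T : ℕ) : E d :=
  (1 / (T : ℝ)) • ∑ t ∈ Finset.range T, iterate f η lam x₀ u t

/-- The search directions `u 0, u 1, …` are independent standard Gaussian vectors. -/
structure IsGaussianDirections {d : ℕ} {Ω : Type*} [MeasurableSpace Ω] (P : Measure Ω)
    (u : ℕ → Ω → E d) : Prop where
  hasLaw : ∀ t, HasLaw (u t) (stdGaussian (E d)) P
  indep : iIndepFun u P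

/-- The random point `X` is, in expectation, an `(ε₁, ε₂)`-approximate flat minimum of `f`:
`𝔼[f(X) - min f] ≤ ε₁` and `𝔼[tr ∇²f(X) - min_{x ∈ argmin f} tr ∇²f(x)] ≤ ε₂`
(both expectations being finite). -/
structure IsApproxFlatMinInExpectation {d : ℕ} {Ω : Type*} [MeasurableSpace Ω] (P : Measure Ω)
    (f : E d → ℝ) (ε₁ ε₂ : ℝ) (X : Ω → E d) : Prop where
  integrable_loss : Integrable (fun ω => f (X ω)) P
  loss_le : ∫ ω, (f (X ω) - ⨅ x, f x) ∂P ≤ ε₁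
  integrable_trace : Integrable (fun ω => trHess f (X ω)) P
  trace_le : ∫ ω, (trHess f (X ω) - ⨅ x : argmin f, trHess f x) ∂P ≤ ε₂

/-- The stepsize `1 / (8 (d + 2) L₁)`. -/
def stepsize (d : ℕ) (L₁ : ℝ) : ℝ :=
  1 / (8 * ((d : ℝ) + 2) * L₁)

/-- The prescribed value of `λ²` for target accuracy `ε`. -/
def lamSq (d : ℕ) (L₁ L₂ L₃ ε : ℝ) : ℝ :=
  min (2 * ε / (L₃ * ((d : ℝ) + 4) ^ 2)) (2 * L₁ * ε / (L₂ ^ 2 * ((d : ℝ) + 8) ^ 4))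

/-- The prescribed lower bound on the number of iterations for target accuracy `ε`, where `R` is
the distance from the initialization to a minimizer of the smoothed function. -/
def iterBound (d : ℕ) (L₁ L₂ L₃ ε R : ℝ) : ℝ :=
  48 * ((d : ℝ) + 2) * L₁ * R ^ 2 / ε *
    max (L₃ * ((d : ℝ) + 4) ^ 2 / (2 * ε)) (L₂ ^ 2 * ((d : ℝ) + 8) ^ 4 / (2 * L₁ * ε))

end FlatMinima

end

open MeasureTheory ProbabilityTheory

noncomputable section

/-! Zeroth-order descent is stochastic gradient descent on the convex function `f_λ`, and `f_λ`
agrees with the trace-regularized loss `F` up to `O(λ⁴)`. Minimizing `f` by two-point queries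
therefore also minimizes the trace of the Hessian, with weight `λ²/2`.

Let `G(x)` be the mean of `g_λ(x, u)`. Stein's identity and the symmetry `u ↦ -u` give `⟨v, G(x)⟩ =
𝔼 ∇f(x + λu)[v]`, so the gradient inequality and the descent inequality of `f` average to the same
inequalities for `f_λ`, with `G` as gradient and constant `L₁`. It is never necessary to
differentiate `f_λ` itself.

The noise is controlled by a chain: Gaussian moments bound `𝔼‖g_λ‖²` by `2(d+2)‖∇f‖²` plus a `λ⁴`
term; `∇f` is within `O(λ²d²)` of `G`; and `‖G‖² ≤ 2 L₁ (f_λ(x) - min f_λ)`. With the given stepsize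
the gap-dependent part of the noise consumes half of the drift of `‖x - x_λ*‖²`
(`integral_norm_step_sq_le`). Independence of `x_t` and `u_t`, telescoping and Jensen then bound the
gap of the averaged iterate for `f_λ`.

In the symmetrized second-order Taylor expansion the odd terms cancel, and the Gaussian mean of
`∇²f(x)[u]²` is the trace. This gives `|f_λ - F| ≤ L₃ λ⁴ (d+4)²/24` (`abs_smoothed_sub_regLoss_le`),
which moves the bound to `F`.

For the prescribed `λ` and `T` the bound is at most `λ²ε/2`. Evaluating `F` at minimizers of `f`
yields `(𝔼 f - min f) + (λ²/2)(𝔼 tr - inf tr) ≤ λ²ε/2`. The loss gap is nonnegative, so the trace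
gap is at most `ε`; and as the trace lies in `[0, d L₁]`, the loss gap is at most `(λ²/2)(ε + d
L₁)`. The rates in part (3) follow by inserting `λ²`. -/

namespace FlatMinima

/-! ### Gaussian density, integration by parts, integrability and symmetry -/

section Gaussian

variable {V : Type*} [NormedAddCommGroup V] [InnerProductSpace ℝ V] [FiniteDimensional ℝ V]
  [MeasurableSpace V] [BorelSpace V]

/-- The normalized Gaussian density. -/
def gaussDensity (x : V) : NNReal :=
  Real.toNNReal ((∫ v : V, Real.exp (-(1 / 2) * ‖v‖ ^ 2))⁻¹ * Real.exp (-(1 / 2) * ‖x‖ ^ 2))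

lemma coe_gaussDensity (x : V) : (gaussDensity x : ℝ) =
    (∫ v : V, Real.exp (-(1 / 2) * ‖v‖ ^ 2))⁻¹ * Real.exp (-(1 / 2) * ‖x‖ ^ 2) := by
  rw [gaussDensity, Real.coe_toNNReal]
  have : 0 ≤ ∫ v : V, Real.exp (-(1 / 2) * ‖v‖ ^ 2) := integral_nonneg fun _ => (Real.exp_pos _).le
  positivity

lemma integrable_exp_neg_half_sq : Integrable fun v : V => Real.exp (-(1 / 2) * ‖v‖ ^ 2) := by
  have h := (GaussianFourier.integrable_cexp_neg_mul_sq_norm_add (V := V) (b := 1 / 2)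
    (by norm_num) 0 0).re
  refine h.congr (Filter.Eventually.of_forall fun v => ?_)
  have : (-(1 / 2 : ℂ) * (‖v‖ : ℂ) ^ 2 + 0 * ((inner ℝ (0 : V) v : ℝ) : ℂ))
      = ((-(1 / 2) * ‖v‖ ^ 2 : ℝ) : ℂ) := by push_cast; ring
  simp only [this]
  exact Complex.exp_ofReal_re _

lemma measurable_gaussDensity : Measurable (gaussDensity : V → NNReal) := by
  unfold gaussDensity; fun_prop

lemma integral_exp_pos : 0 < ∫ v : V, Real.exp (-(1 / 2) * ‖v‖ ^ 2) := by
  rw [GaussianFourier.integral_rexp_neg_mul_sq_norm (by norm_num)]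
  positivity

lemma integrable_gaussDensity : Integrable fun x : V => (gaussDensity x : ℝ) := by
  simp_rw [coe_gaussDensity]
  exact integrable_exp_neg_half_sq.const_mul _

/-- The standard Gaussian measure has the Gaussian density with respect to Lebesgue measure. -/
lemma stdGaussian_eq_withDensity :
    stdGaussian V = (volume : Measure V).withDensity fun x => (gaussDensity x : ENNReal) := by
  have hfin : IsFiniteMeasure ((volume : Measure V).withDensity
      fun x => (gaussDensity x : ENNReal)) := by
    refine isFiniteMeasure_withDensity ?_
    have := (integrable_gaussDensity (V := V)).lintegral_lt_top
    simp only [ENNReal.ofReal_coe_nnreal] at this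
    exact this.ne
  refine Measure.ext_of_charFun ?_
  ext t
  rw [charFun_stdGaussian, charFun_apply,
    integral_withDensity_eq_integral_smul measurable_gaussDensity]
  have hZ := GaussianFourier.integral_cexp_neg_mul_sq_norm (V := V) (b := 1 / 2) (by norm_num)
  have hI := GaussianFourier.integral_cexp_neg_mul_sq_norm_add (V := V) (b := 1 / 2) (by norm_num)
    Complex.I t
  -- The prefactor `(π/b)^(n/2)` in `hI` is the total mass, so it cancels against the normalizing
  -- constant.
  rw [← hZ] at hI
  have hZ' : ∫ v : V, Complex.exp (-(1 / 2) * ‖v‖ ^ 2)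
      = ((∫ v : V, Real.exp (-(1 / 2) * ‖v‖ ^ 2) : ℝ) : ℂ) := by
    rw [← integral_complex_ofReal]; push_cast; rfl
  have h1 : ∀ x : V, gaussDensity x • Complex.exp (((inner ℝ x t : ℝ) : ℂ) * Complex.I)
      = ((∫ v : V, Real.exp (-(1 / 2) * ‖v‖ ^ 2) : ℝ) : ℂ)⁻¹ *
        Complex.exp (-(1 / 2) * ‖x‖ ^ 2 + Complex.I * ((inner ℝ t x : ℝ) : ℂ)) := by
    intro x
    rw [NNReal.smul_def, coe_gaussDensity, Complex.real_smul, Complex.exp_add,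
      real_inner_comm t x, mul_comm Complex.I]
    push_cast
    ring
  simp_rw [h1]
  rw [integral_const_mul, hI, hZ', ← mul_assoc, inv_mul_cancel₀, one_mul]
  · congr 1
    rw [Complex.I_sq]; ring
  · exact_mod_cast integral_exp_pos.ne'

lemma hasFDerivAt_gaussDensity (x : V) :
    HasFDerivAt (fun y : V => (gaussDensity y : ℝ))
      (-(gaussDensity x : ℝ) • (innerSL ℝ x : V →L[ℝ] ℝ)) x := by
  simp_rw [coe_gaussDensity]
  have h := (((hasStrictFDerivAt_norm_sq x).hasFDerivAt.const_mul (-(1 / 2) : ℝ)).exp.const_mul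
    (∫ v : V, Real.exp (-(1 / 2) * ‖v‖ ^ 2))⁻¹)
  refine h.congr_fderiv ?_
  ext v
  simp
  ring

/-- **Stein's identity** (Gaussian integration by parts). -/
lemma stein {h : V → ℝ} {h' : V → V →L[ℝ] ℝ} (v : V) (hh : ∀ x, HasFDerivAt h (h' x) x)
    (i₀ : Integrable h (stdGaussian V))
    (i₁ : Integrable (fun x => h' x v) (stdGaussian V))
    (i₂ : Integrable (fun x => inner ℝ x v * h x) (stdGaussian V)) :
    ∫ x, inner ℝ x v * h x ∂(stdGaussian V) = ∫ x, h' x v ∂(stdGaussian V) := by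
  rw [stdGaussian_eq_withDensity] at *
  rw [integrable_withDensity_iff_integrable_coe_smul measurable_gaussDensity] at i₀ i₁ i₂
  rw [integral_withDensity_eq_integral_smul measurable_gaussDensity,
    integral_withDensity_eq_integral_smul measurable_gaussDensity]
  -- Integration by parts against Lebesgue measure: the density has derivative `-φ(x)⟨x, ·⟩`, whose
  -- sign cancels that of the formula.
  have := integral_bilinear_hasFDerivAt_right_eq_neg_left_of_integrable
    (μ := (volume : Measure V)) (f := h) (f' := h') (g := fun y : V => (gaussDensity y : ℝ))
    (g' := fun x => -(gaussDensity x : ℝ) • (innerSL ℝ x : V →L[ℝ] ℝ)) (v := v)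
    (B := ContinuousLinearMap.mul ℝ ℝ) ?_ ?_ ?_ (fun x _ => hh x)
    (fun x _ => hasFDerivAt_gaussDensity x)
  · have e₁ : ∫ x : V, gaussDensity x • (inner ℝ x v * h x) = -∫ x : V,
        ContinuousLinearMap.mul ℝ ℝ (h x) ((-(gaussDensity x : ℝ) • (innerSL ℝ x : V →L[ℝ] ℝ)) v) := by
      rw [← integral_neg]
      congr 1; ext x; simp [NNReal.smul_def]; ring
    rw [e₁, this, neg_neg]
    congr 1; ext x; simp [NNReal.smul_def, mul_comm]
  · refine i₁.congr (.of_forall fun x => ?_); simp; ring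
  · refine i₂.neg.congr (.of_forall fun x => ?_); simp; ring
  · refine i₀.congr (.of_forall fun x => ?_); simp; ring

lemma integrable_norm_pow_stdGaussian (n : ℕ) :
    Integrable (fun x : V => ‖x‖ ^ n) (stdGaussian V) := by
  have := (IsGaussian.memLp_id (stdGaussian V) (n : ENNReal) (by simp)).integrable_norm_pow'
  simpa using this

/-- Continuous functions of polynomial growth are Gaussian integrable. -/
lemma integrable_of_le_pow {W : Type*} [NormedAddCommGroup W] {h : V → W}
    [SecondCountableTopologyEither V W]
    (hc : Continuous h) (C : ℝ) (n : ℕ) (hb : ∀ x, ‖h x‖ ≤ C * (1 + ‖x‖) ^ n) :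
    Integrable h (stdGaussian V) := by
  have : Integrable (fun x : V => C * (1 + ‖x‖) ^ n) (stdGaussian V) := by
    simp_rw [add_pow]
    refine (integrable_finsetSum _ fun i _ => ?_).const_mul _
    refine Integrable.mul_const ?_ _
    simpa using integrable_norm_pow_stdGaussian (V := V) _
  exact this.mono' hc.aestronglyMeasurable (.of_forall hb)

lemma integral_comp_neg_stdGaussian {W : Type*} [NormedAddCommGroup W] [NormedSpace ℝ W]
    (h : V → W) : ∫ x, h (-x) ∂(stdGaussian V) = ∫ x, h x ∂(stdGaussian V) := by
  have := stdGaussian_map (E := V) (LinearIsometryEquiv.neg ℝ (E := V))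
  conv_rhs => rw [← this]
  exact ((LinearIsometryEquiv.neg ℝ (E := V)).toHomeomorph.measurableEmbedding.integral_map
    _).symm

end Gaussian

/-! ### Gaussian moments from Stein's identity -/

section Moments

variable {V : Type*} [NormedAddCommGroup V] [InnerProductSpace ℝ V] [FiniteDimensional ℝ V]
  [MeasurableSpace V] [BorelSpace V]

/-- The covariance is the identity: Stein's identity for a linear function, whose derivative is
constant. -/
lemma integral_inner_mul_clm (v : V) (L : V →L[ℝ] ℝ) :
    ∫ x, inner ℝ x v * L x ∂(stdGaussian V) = L v := by
  rw [stein v (h := L) (h' := fun _ => L) (fun x => L.hasFDerivAt)]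
  · simp
  · refine integrable_of_le_pow (by fun_prop) ‖L‖ 1 fun x => ?_
    refine (L.le_opNorm x).trans ?_
    gcongr; simp
  · exact integrable_const _
  · refine integrable_of_le_pow (by fun_prop) (‖v‖ * ‖L‖) 2 fun x => ?_
    rw [norm_mul]
    calc _ ≤ (‖x‖ * ‖v‖) * (‖L‖ * ‖x‖) :=
          mul_le_mul (norm_inner_le_norm _ _) (L.le_opNorm x) (norm_nonneg _) (by positivity)
      _ = ‖v‖ * ‖L‖ * ‖x‖ ^ 2 := by ring
      _ ≤ _ := by gcongr; simp

omit [FiniteDimensional ℝ V] [MeasurableSpace V] [BorelSpace V] in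
lemma hasFDerivAt_inner_mul_norm_sq_pow (a : V) (k : ℕ) (x : V) :
    HasFDerivAt (fun y : V => inner ℝ y a * (‖y‖ ^ 2) ^ k)
      ((inner ℝ x a) • ((k * (‖x‖ ^ 2) ^ (k - 1)) • (2 • (innerSL ℝ x : V →L[ℝ] ℝ)))
        + ((‖x‖ ^ 2) ^ k) • (innerSL ℝ a : V →L[ℝ] ℝ)) x := by
  have h₁ : HasFDerivAt (fun y : V => inner ℝ y a) (innerSL ℝ a : V →L[ℝ] ℝ) x := by
    simp_rw [real_inner_comm a]
    exact (innerSL ℝ a : V →L[ℝ] ℝ).hasFDerivAt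
  have h₂ := h₁.mul ((hasStrictFDerivAt_norm_sq x).hasFDerivAt.pow k)
  simp only [nsmul_eq_mul] at h₂
  exact h₂

/-- Stein's identity in direction `a` for `⟨y, a⟩ ‖y‖^(2k)`; the two terms come from the product
rule. For `k = 0` the truncated exponent `k - 1` is harmless because its coefficient vanishes. -/
lemma integral_inner_sq_mul_norm_pow (a : V) (k : ℕ) :
    ∫ x, inner ℝ x a ^ 2 * (‖x‖ ^ 2) ^ k ∂(stdGaussian V) =
      ∫ x, (2 * k * (inner ℝ x a ^ 2 * (‖x‖ ^ 2) ^ (k - 1)) + ‖a‖ ^ 2 * (‖x‖ ^ 2) ^ k)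
        ∂(stdGaussian V) := by
  have h1 : ∀ (x : V) (m : ℕ), ‖x‖ ^ m ≤ (1 + ‖x‖) ^ m := fun x m => by gcongr; simp
  have hi : ∀ x : V, |inner ℝ x a| ≤ ‖x‖ * ‖a‖ := fun x => abs_real_inner_le_norm _ _
  have hi2 : ∀ x : V, inner ℝ x a ^ 2 ≤ ‖a‖ ^ 2 * ‖x‖ ^ 2 := fun x => by
    rw [← sq_abs]
    calc _ ≤ (‖x‖ * ‖a‖) ^ 2 := by gcongr; exact hi x
      _ = _ := by ring
  have i2 : ∀ m : ℕ, Integrable (fun x : V => inner ℝ x a ^ 2 * (‖x‖ ^ 2) ^ m)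
      (stdGaussian V) := fun m => by
    refine integrable_of_le_pow (by fun_prop) (‖a‖ ^ 2) (2 + 2 * m) fun x => ?_
    rw [Real.norm_of_nonneg (by positivity)]
    calc _ ≤ (‖a‖ ^ 2 * ‖x‖ ^ 2) * (‖x‖ ^ 2) ^ m := by gcongr; exact hi2 x
      _ = ‖a‖ ^ 2 * ‖x‖ ^ (2 + 2 * m) := by ring
      _ ≤ _ := by gcongr; simp
  have key := stein a (hasFDerivAt_inner_mul_norm_sq_pow a k) ?_ ?_ ?_
  · convert key using 2
    · ext x; ring
    · ext x; simp; ring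
  · refine integrable_of_le_pow (by fun_prop) ‖a‖ (1 + 2 * k) fun x => ?_
    rw [norm_mul, Real.norm_of_nonneg (by positivity : 0 ≤ (‖x‖ ^ 2) ^ k)]
    calc _ ≤ (‖x‖ * ‖a‖) * (‖x‖ ^ 2) ^ k := by gcongr; exact hi x
      _ = ‖a‖ * ‖x‖ ^ (1 + 2 * k) := by ring
      _ ≤ _ := by gcongr; simp
  · refine (((i2 (k - 1)).const_mul (2 * k)).add
      ((integrable_norm_pow_stdGaussian (2 * k)).const_mul (‖a‖ ^ 2))).congr
      (.of_forall fun x => ?_)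
    simp [pow_mul]; ring
  · refine (i2 k).congr (.of_forall fun x => ?_)
    simp only; ring

lemma integrable_norm_sq_pow (k : ℕ) :
    Integrable (fun x : V => (‖x‖ ^ 2) ^ k) (stdGaussian V) := by
  simp_rw [← pow_mul]; exact integrable_norm_pow_stdGaussian _

lemma integrable_inner_sq_mul_norm_pow (a : V) (k : ℕ) :
    Integrable (fun x : V => inner ℝ x a ^ 2 * (‖x‖ ^ 2) ^ k) (stdGaussian V) := by
  refine ((integrable_norm_sq_pow (V := V) (k + 1)).const_mul (‖a‖ ^ 2)).mono'
    (by fun_prop) (.of_forall fun x => ?_)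
  rw [Real.norm_of_nonneg (by positivity), ← sq_abs]
  calc _ ≤ (‖x‖ * ‖a‖) ^ 2 * (‖x‖ ^ 2) ^ k := by gcongr; exact abs_real_inner_le_norm _ _
    _ = _ := by ring

/-- Recursion for the even moments of the norm of a standard Gaussian vector. -/
lemma integral_norm_sq_pow_succ (k : ℕ) :
    ∫ x : V, (‖x‖ ^ 2) ^ (k + 1) ∂(stdGaussian V) =
      (Module.finrank ℝ V + 2 * k) * ∫ x : V, (‖x‖ ^ 2) ^ k ∂(stdGaussian V) := by
  -- Summing the directional identity over an orthonormal basis, the `‖b i‖²` contribute the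
  -- dimension and the `⟨x, b i⟩²` add up to `‖x‖²`.
  set b := stdOrthonormalBasis ℝ V
  have hb : ∀ x : V, ∑ i, inner ℝ x (b i) ^ 2 = ‖x‖ ^ 2 := fun x => by
    rw [← b.sum_sq_norm_inner_left x]; simp
  have e₁ : ∀ x : V, (‖x‖ ^ 2) ^ (k + 1) = ∑ i, inner ℝ x (b i) ^ 2 * (‖x‖ ^ 2) ^ k := fun x => by
    rw [← Finset.sum_mul, hb, pow_succ, mul_comm]
  simp_rw [e₁]
  rw [integral_finsetSum _ fun i _ => integrable_inner_sq_mul_norm_pow (b i) k]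
  simp_rw [integral_inner_sq_mul_norm_pow]
  have hi : ∀ i, Integrable (fun x : V => 2 * k * (inner ℝ x (b i) ^ 2 * (‖x‖ ^ 2) ^ (k - 1)) +
      ‖b i‖ ^ 2 * (‖x‖ ^ 2) ^ k) (stdGaussian V) := fun i =>
    ((integrable_inner_sq_mul_norm_pow (b i) (k - 1)).const_mul _).add
      ((integrable_norm_sq_pow k).const_mul _)
  rw [← integral_finsetSum _ fun i _ => hi i, ← integral_const_mul]
  congr 1
  ext x
  rw [Finset.sum_add_distrib, ← Finset.mul_sum, ← Finset.sum_mul, ← Finset.sum_mul, hb]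
  simp only [OrthonormalBasis.norm_eq_one, one_pow, Finset.sum_const, Finset.card_univ,
    Fintype.card_fin, nsmul_eq_mul, mul_one]
  -- The truncated exponent `k - 1` forces the case `k = 0` to be treated apart.
  rcases k with _ | k
  · simp
  · simp [pow_succ]; ring

lemma integral_norm_sq : ∫ x : V, ‖x‖ ^ 2 ∂(stdGaussian V) = Module.finrank ℝ V := by
  simpa using integral_norm_sq_pow_succ (V := V) 0

lemma integral_norm_pow_four : ∫ x : V, ‖x‖ ^ 4 ∂(stdGaussian V) =
    Module.finrank ℝ V * (Module.finrank ℝ V + 2) := by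
  have := integral_norm_sq_pow_succ (V := V) 1
  simp only [← pow_mul, Nat.reduceAdd, Nat.reduceMul, integral_norm_sq] at this
  rw [this]; push_cast; ring

lemma integral_norm_pow_eight : ∫ x : V, ‖x‖ ^ 8 ∂(stdGaussian V) =
    Module.finrank ℝ V * (Module.finrank ℝ V + 2) * (Module.finrank ℝ V + 4) *
      (Module.finrank ℝ V + 6) := by
  have h₂ := integral_norm_sq_pow_succ (V := V) 2
  have h₃ := integral_norm_sq_pow_succ (V := V) 3
  simp only [← pow_mul, Nat.reduceAdd, Nat.reduceMul, integral_norm_pow_four] at h₂ h₃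
  rw [h₃, h₂]; push_cast; ring

lemma integral_inner_sq (a : V) : ∫ x, inner ℝ x a ^ 2 ∂(stdGaussian V) = ‖a‖ ^ 2 := by
  simpa using integral_inner_sq_mul_norm_pow a 0

lemma integral_inner_sq_mul_norm_sq (a : V) :
    ∫ x, inner ℝ x a ^ 2 * ‖x‖ ^ 2 ∂(stdGaussian V) = (Module.finrank ℝ V + 2) * ‖a‖ ^ 2 := by
  have h := integral_inner_sq_mul_norm_pow a 1
  rw [integral_add ((integrable_inner_sq_mul_norm_pow a _).const_mul _)
    ((integrable_norm_sq_pow 1).const_mul _), integral_const_mul, integral_const_mul] at h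
  simp only [pow_one, Nat.sub_self, pow_zero, mul_one, integral_inner_sq, integral_norm_sq] at h
  rw [h]; push_cast; ring

end Moments

/-! ### Taylor estimates along lines, and the trace of the Hessian -/

/-- The `k`-th directional derivative of `f` at `x` along `u`. -/
abbrev dirDeriv {d : ℕ} (k : ℕ) (f : E d → ℝ) (x u : E d) : ℝ :=
  iteratedFDeriv ℝ k f x (fun _ => u)

/-- The mean value inequality in a form that can be iterated: each use integrates a power bound
once, so Taylor remainders with sharp constants need no integrals. -/
lemma abs_le_of_abs_deriv_le_pow {φ φ' : ℝ → ℝ} {C : ℝ} {n : ℕ}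
    (hφ : ∀ t, HasDerivAt φ (φ' t) t) (h0 : φ 0 = 0)
    (hb : ∀ t, 0 ≤ t → |φ' t| ≤ C * t ^ n) {t : ℝ} (ht : 0 ≤ t) :
    |φ t| ≤ C / (n + 1) * t ^ (n + 1) := by
  have hB : ∀ x : ℝ, HasDerivAt (fun x => C / (n + 1) * x ^ (n + 1)) (C * x ^ n) x := fun x => by
    refine ((hasDerivAt_pow (n + 1) x).const_mul (C / (n + 1))).congr_deriv ?_
    have : (n + 1 : ℝ) ≠ 0 := by positivity
    push_cast
    field_simp
  have := image_norm_le_of_norm_deriv_right_le_deriv_boundary (f := φ) (f' := φ') (a := 0) (b := t)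
    (fun x _ => (hφ x).continuousAt.continuousWithinAt) (fun x _ => (hφ x).hasDerivWithinAt)
    (by simp [h0]) hB (fun x hx => hb x hx.1)
  exact this ⟨ht, le_rfl⟩

section Line

variable {d : ℕ} {f : E d → ℝ}

lemma dirDeriv_zero (x u : E d) : dirDeriv 0 f x u = f x := by simp [dirDeriv]

lemma dirDeriv_one (x u : E d) : dirDeriv 1 f x u = fderiv ℝ f x u := by
  simp [dirDeriv, iteratedFDeriv_one_apply]

lemma dirDeriv_smul (k : ℕ) (c : ℝ) (x u : E d) :
    dirDeriv k f x (c • u) = c ^ k * dirDeriv k f x u := by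
  simp only [dirDeriv]
  rw [ContinuousMultilinearMap.map_smul_univ (iteratedFDeriv ℝ k f x) (fun _ => c) (fun _ => u)]
  simp

lemma hasDerivAt_dirDeriv {n k : ℕ} (hf : ContDiff ℝ n f) (hk : k < n) (x u : E d) (t : ℝ) :
    HasDerivAt (fun t : ℝ => dirDeriv k f (x + t • u) u) (dirDeriv (k + 1) f (x + t • u) u) t := by
  have h₁ := (hf.differentiable_iteratedFDeriv (m := k) (by exact_mod_cast hk)
    (x + t • u)).hasFDerivAt
  have h₂ : HasDerivAt (fun t : ℝ => x + t • u) u t := by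
    simpa using ((hasDerivAt_id t).smul_const u).const_add x
  have h₃ := h₁.comp_hasDerivAt t h₂
  have h₄ := ((ContinuousMultilinearMap.apply ℝ (fun _ : Fin k => E d) ℝ
    (fun _ => u)).hasFDerivAt).comp_hasDerivAt t h₃
  -- The derivative of `iteratedFDeriv` of order `k` is, by definition, the one of order `k + 1`
  -- with `u` inserted in the first slot.
  exact h₄

lemma hasDerivAt_dirDeriv_neg {n k : ℕ} (hf : ContDiff ℝ n f) (hk : k < n) (x u : E d) (t : ℝ) :
    HasDerivAt (fun t : ℝ => dirDeriv k f (x - t • u) u)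
      (-dirDeriv (k + 1) f (x - t • u) u) t := by
  have h := hasDerivAt_dirDeriv hf hk x u (-t)
  have h' := h.comp t (hasDerivAt_neg t)
  simpa [Function.comp_def, sub_eq_add_neg] using h'

/-- Homogeneity of degree `r` removes the restriction to the unit ball. -/
lemma SmoothOfOrder.abs_sub_le {r : ℕ} {L : ℝ} (h : SmoothOfOrder r L f) (x y u : E d) :
    |dirDeriv r f x u - dirDeriv r f y u| ≤ L * ‖u‖ ^ r * ‖x - y‖ := by
  -- For `u = 0` this is `0`, which still lies in the unit ball.
  set s : E d := ‖u‖⁻¹ • u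
  have hs : ‖s‖ ≤ 1 := by
    rw [norm_smul, norm_inv, norm_norm]
    exact inv_mul_le_one
  have hu : u = ‖u‖ • s := by
    rcases eq_or_ne u 0 with rfl | h0
    · simp
    · rw [smul_smul, mul_inv_cancel₀ (norm_ne_zero_iff.2 h0), one_smul]
  have hd : ∀ z, dirDeriv r f z u = ‖u‖ ^ r * dirDeriv r f z s := fun z => by
    conv_lhs => rw [hu]
    rw [dirDeriv_smul]
  rw [hd, hd, ← mul_sub, abs_mul, abs_of_nonneg (by positivity : 0 ≤ ‖u‖ ^ r)]
  calc _ ≤ ‖u‖ ^ r * (L * ‖x - y‖) := by gcongr; exact h.2 x y s hs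
    _ = _ := by ring

lemma add_sub_norm (x u : E d) {t : ℝ} (ht : 0 ≤ t) : ‖(x + t • u) - (x - t • u)‖ = 2 * t * ‖u‖ := by
  have : (x + t • u) - (x - t • u) = (2 * t) • u := by rw [mul_smul, two_smul]; abel
  rw [this, norm_smul, Real.norm_of_nonneg (by positivity)]

lemma SmoothOfOrder.abs_fderiv_sub_le {L : ℝ} (h : SmoothOfOrder 1 L f) (x y u : E d) :
    |fderiv ℝ f x u - fderiv ℝ f y u| ≤ L * ‖u‖ * ‖x - y‖ := by
  have := h.abs_sub_le x y u
  simpa only [dirDeriv_one, pow_one] using this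

lemma SmoothOfOrder.abs_sub_sub_fderiv_le {L : ℝ} (h : SmoothOfOrder 1 L f) (x u : E d) :
    |f (x + u) - f x - fderiv ℝ f x u| ≤ L / 2 * ‖u‖ ^ 2 := by
  have := abs_le_of_abs_deriv_le_pow (φ := fun t : ℝ => dirDeriv 0 f (x + t • u) u - f x -
      t * dirDeriv 1 f x u) (φ' := fun t => dirDeriv 1 f (x + t • u) u - dirDeriv 1 f x u)
      (C := L * ‖u‖ ^ 2) (n := 1) (fun t => ?_) ?_ (fun t ht => ?_) zero_le_one
  · simp only [one_smul, dirDeriv_zero, dirDeriv_one, one_mul] at this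
    refine this.trans (le_of_eq ?_)
    push_cast; ring
  · have := ((hasDerivAt_dirDeriv h.1 zero_lt_one x u t).sub_const (f x)).sub
      ((hasDerivAt_id t).mul_const (dirDeriv 1 f x u))
    exact this.congr_deriv (by simp)
  · simp
  · refine (h.abs_sub_le _ _ u).trans (le_of_eq ?_)
    rw [add_sub_cancel_left, norm_smul, Real.norm_of_nonneg ht]; ring

/-- The odd difference has second derivative `∇²f(x+tu)[u]² - ∇²f(x-tu)[u]²`, at most `2L‖u‖³t`
because the points are `2t‖u‖` apart. Two integrations turn `2t` into `t²` and then `t³/3`. -/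
lemma SmoothOfOrder.abs_central_diff_le {L : ℝ} (h : SmoothOfOrder 2 L f) (x u : E d) {lam : ℝ}
    (hl : 0 ≤ lam) :
    |f (x + lam • u) - f (x - lam • u) - 2 * lam * fderiv ℝ f x u| ≤ L / 3 * lam ^ 3 * ‖u‖ ^ 3 := by
  have h₁ := fun t (ht : (0 : ℝ) ≤ t) => abs_le_of_abs_deriv_le_pow (φ := fun t : ℝ =>
      dirDeriv 1 f (x + t • u) u + dirDeriv 1 f (x - t • u) u - 2 * dirDeriv 1 f x u)
      (φ' := fun t => dirDeriv 2 f (x + t • u) u - dirDeriv 2 f (x - t • u) u)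
      (C := 2 * L * ‖u‖ ^ 3) (n := 1) (fun t => ?_) ?_ (fun t ht => ?_) ht
  rotate_left
  · have := ((hasDerivAt_dirDeriv h.1 one_lt_two x u t).add
      (hasDerivAt_dirDeriv_neg h.1 one_lt_two x u t)).sub_const (2 * dirDeriv 1 f x u)
    exact this.congr_deriv (by simp [sub_eq_add_neg])
  · simp; ring
  · refine (h.abs_sub_le _ _ u).trans (le_of_eq ?_)
    rw [add_sub_norm x u ht]; ring
  have := abs_le_of_abs_deriv_le_pow (φ := fun t : ℝ =>
      dirDeriv 0 f (x + t • u) u - dirDeriv 0 f (x - t • u) u - t * (2 * dirDeriv 1 f x u))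
      (φ' := fun t => dirDeriv 1 f (x + t • u) u + dirDeriv 1 f (x - t • u) u
        - 2 * dirDeriv 1 f x u)
      (C := L * ‖u‖ ^ 3) (n := 2) (fun t => ?_) ?_ (fun t ht => ?_) hl
  · simp only [dirDeriv_zero, dirDeriv_one] at this
    convert this using 1
    · congr 1; ring
    · push_cast; ring
  · have := ((hasDerivAt_dirDeriv h.1 zero_lt_two x u t).sub
      (hasDerivAt_dirDeriv_neg h.1 zero_lt_two x u t)).sub
      ((hasDerivAt_id t).mul_const (2 * dirDeriv 1 f x u))
    exact this.congr_deriv (by simp)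
  · simp
  · refine (h₁ t ht).trans (le_of_eq ?_)
    push_cast; ring

/-- The even average loses its odd Taylor terms, and its third derivative is half of a difference of
`∇³f` at points `2t‖u‖` apart. Three integrations turn `t` into `t²/2`, `t³/6`, `t⁴/24`. -/
lemma SmoothOfOrder.abs_second_diff_le {L : ℝ} (h : SmoothOfOrder 3 L f) (x u : E d) {lam : ℝ}
    (hl : 0 ≤ lam) :
    |(f (x + lam • u) + f (x - lam • u)) / 2 - f x - lam ^ 2 / 2 * dirDeriv 2 f x u|
      ≤ L / 24 * lam ^ 4 * ‖u‖ ^ 4 := by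
  have h₁ := fun t (ht : (0 : ℝ) ≤ t) => abs_le_of_abs_deriv_le_pow (φ := fun t : ℝ =>
      (dirDeriv 2 f (x + t • u) u + dirDeriv 2 f (x - t • u) u) / 2 - dirDeriv 2 f x u)
      (φ' := fun t => (dirDeriv 3 f (x + t • u) u - dirDeriv 3 f (x - t • u) u) / 2)
      (C := L * ‖u‖ ^ 4) (n := 1) (fun t => ?_) ?_ (fun t ht => ?_) ht
  rotate_left
  · have := (((hasDerivAt_dirDeriv h.1 (k := 2) (by norm_num) x u t).add
      (hasDerivAt_dirDeriv_neg h.1 (k := 2) (by norm_num) x u t)).div_const 2).sub_const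
        (dirDeriv 2 f x u)
    exact this.congr_deriv (by simp [sub_eq_add_neg])
  · simp
  · rw [abs_div, abs_two]
    have := h.abs_sub_le (x + t • u) (x - t • u) u
    rw [add_sub_norm x u ht] at this
    linarith
  have h₂ := fun t (ht : (0 : ℝ) ≤ t) => abs_le_of_abs_deriv_le_pow (φ := fun t : ℝ =>
      (dirDeriv 1 f (x + t • u) u - dirDeriv 1 f (x - t • u) u) / 2 - t * dirDeriv 2 f x u)
      (φ' := fun t => (dirDeriv 2 f (x + t • u) u + dirDeriv 2 f (x - t • u) u) / 2
        - dirDeriv 2 f x u)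
      (C := L * ‖u‖ ^ 4 / 2) (n := 2) (fun t => ?_) ?_ (fun t ht => ?_) ht
  rotate_left
  · have := (((hasDerivAt_dirDeriv h.1 (k := 1) (by norm_num) x u t).sub
      (hasDerivAt_dirDeriv_neg h.1 (k := 1) (by norm_num) x u t)).div_const 2).sub
        ((hasDerivAt_id t).mul_const (dirDeriv 2 f x u))
    exact this.congr_deriv (by simp [sub_eq_add_neg])
  · simp
  · refine (h₁ t ht).trans (le_of_eq ?_)
    push_cast; ring
  have h₃ := abs_le_of_abs_deriv_le_pow (φ := fun t : ℝ =>
      (dirDeriv 0 f (x + t • u) u + dirDeriv 0 f (x - t • u) u) / 2 - dirDeriv 0 f x u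
        - t ^ 2 * (dirDeriv 2 f x u / 2))
      (φ' := fun t => (dirDeriv 1 f (x + t • u) u - dirDeriv 1 f (x - t • u) u) / 2
        - t * dirDeriv 2 f x u)
      (C := L * ‖u‖ ^ 4 / 6) (n := 3) (fun t => ?_) ?_ (fun t ht => ?_) hl
  · simp only [dirDeriv_zero] at h₃
    convert h₃ using 1
    · congr 1; ring
    · push_cast; ring
  · have := ((((hasDerivAt_dirDeriv h.1 (k := 0) (by norm_num) x u t).add
      (hasDerivAt_dirDeriv_neg h.1 (k := 0) (by norm_num) x u t)).div_const 2).sub_const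
        (dirDeriv 0 f x u)).sub ((hasDerivAt_pow 2 t).mul_const (dirDeriv 2 f x u / 2))
    refine this.congr_deriv ?_
    push_cast; simp; ring
  · simp
  · refine (h₂ t ht).trans (le_of_eq ?_)
    push_cast; ring

lemma convex_fderiv_le (hf : Differentiable ℝ f) (hc : ConvexOn ℝ Set.univ f) (x y : E d) :
    f x + fderiv ℝ f x (y - x) ≤ f y := by
  have hφ : ConvexOn ℝ Set.univ (fun t : ℝ => f (x + t • (y - x))) := by
    have := hc.comp_affineMap (AffineMap.lineMap x y : ℝ →ᵃ[ℝ] E d)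
    simpa [Function.comp_def, AffineMap.lineMap_apply, add_comm] using this
  have h₂ : HasDerivAt (fun t : ℝ => x + t • (y - x)) (y - x) 0 := by
    simpa using ((hasDerivAt_id (0 : ℝ)).smul_const (y - x)).const_add x
  have h₃ : HasDerivAt (fun t : ℝ => f (x + t • (y - x))) (fderiv ℝ f x (y - x)) 0 := by
    have h₁ : HasFDerivAt f (fderiv ℝ f x) (x + (0 : ℝ) • (y - x)) := by
      simpa using (hf x).hasFDerivAt
    exact h₁.comp_hasDerivAt 0 h₂
  have := hφ.le_slope_of_hasDerivAt (Set.mem_univ 0) (Set.mem_univ 1) zero_lt_one h₃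
  simp only [slope_def_field, one_smul, zero_smul, add_zero, add_sub_cancel, sub_zero, div_one] at this
  linarith

/-- Adding the gradient inequality at two points of a line, in both directions, makes the slope
monotone, so its derivative is nonnegative. -/
lemma dirDeriv_two_nonneg (hf : ContDiff ℝ 2 f) (hc : ConvexOn ℝ Set.univ f) (x u : E d) :
    0 ≤ dirDeriv 2 f x u := by
  have hd := hasDerivAt_dirDeriv hf one_lt_two x u 0
  have hD : Differentiable ℝ f := hf.differentiable (by norm_num)
  have hm : Monotone (fun t : ℝ => dirDeriv 1 f (x + t • u) u) := by
    intro s t hst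
    simp only [dirDeriv_one]
    rcases hst.eq_or_lt with rfl | hst
    · rfl
    have h₁ := convex_fderiv_le hD hc (x + s • u) (x + t • u)
    have h₂ := convex_fderiv_le hD hc (x + t • u) (x + s • u)
    have e₁ : x + t • u - (x + s • u) = (t - s) • u := by rw [sub_smul]; abel
    have e₂ : x + s • u - (x + t • u) = -((t - s) • u) := by rw [sub_smul]; abel
    rw [e₁] at h₁
    rw [e₂] at h₂
    simp only [map_neg, map_smul, smul_eq_mul] at h₁ h₂
    have : 0 < t - s := sub_pos.2 hst
    nlinarith
  have := hm.deriv_nonneg (x := 0)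
  rw [hd.deriv] at this
  simpa using this

lemma SmoothOfOrder.abs_dirDeriv_two_le {L : ℝ} (hL : 0 ≤ L) (h : SmoothOfOrder 1 L f)
    (hf : ContDiff ℝ 2 f) (x u : E d) : |dirDeriv 2 f x u| ≤ L * ‖u‖ ^ 2 := by
  have hd := hasDerivAt_dirDeriv hf one_lt_two x u 0
  have := hd.le_of_lip' (C := L * ‖u‖ ^ 2) (by positivity) (.of_forall fun t => ?_)
  · simpa using this
  · refine (h.abs_sub_le _ _ u).trans (le_of_eq ?_)
    rw [add_sub_add_left_eq_sub, ← sub_smul, norm_smul]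
    ring

lemma trHess_eq_sum (x : E d) :
    trHess f x = ∑ i, dirDeriv 2 f x (EuclideanSpace.single i (1 : ℝ)) := by
  simp only [trHess, hessian, Matrix.trace, Matrix.diag, Matrix.of_apply, dirDeriv]
  refine Finset.sum_congr rfl fun i _ => ?_
  congr 1
  ext j : 1
  fin_cases j <;> rfl

lemma trHess_nonneg (hf : ContDiff ℝ 2 f) (hc : ConvexOn ℝ Set.univ f) (x : E d) :
    0 ≤ trHess f x := by
  rw [trHess_eq_sum]
  exact Finset.sum_nonneg fun i _ => dirDeriv_two_nonneg hf hc _ _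

lemma SmoothOfOrder.trHess_le {L : ℝ} (hL : 0 ≤ L) (h : SmoothOfOrder 1 L f)
    (hf : ContDiff ℝ 2 f) (x : E d) : trHess f x ≤ d * L := by
  rw [trHess_eq_sum]
  calc _ ≤ ∑ _i : Fin d, L := Finset.sum_le_sum fun i _ => by
        have := (le_abs_self _).trans (h.abs_dirDeriv_two_le hL hf x (EuclideanSpace.single i (1 : ℝ)))
        simpa using this
    _ = _ := by simp

lemma continuous_trHess (hf : ContDiff ℝ 2 f) : Continuous (trHess f) := by
  have : trHess f = fun x => ∑ i, dirDeriv 2 f x (EuclideanSpace.single i (1 : ℝ)) :=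
    funext trHess_eq_sum
  rw [this]
  refine continuous_finsetSum _ fun i _ => ?_
  exact (ContinuousMultilinearMap.apply ℝ (fun _ : Fin 2 => E d) ℝ (fun _ =>
    EuclideanSpace.single i (1 : ℝ))).continuous.comp
      (hf.continuous_iteratedFDeriv (m := 2) le_rfl)

lemma continuous_dirDeriv (k : ℕ) (x : E d) : Continuous fun u => dirDeriv k f x u :=
  (iteratedFDeriv ℝ k f x).cont.comp (by fun_prop)

/-- The Gaussian average of the second directional derivative is the trace of the Hessian. -/
lemma integral_dirDeriv_two (x : E d) :
    ∫ u, dirDeriv 2 f x u ∂(stdGaussian (E d)) = trHess f x := by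
  set B := fderiv ℝ (fderiv ℝ f) x
  -- Expanding only the first slot of the Hessian leaves terms `⟨u, eᵢ⟩` times a linear form in `u`,
  -- to which the covariance identity applies.
  have e : ∀ u, dirDeriv 2 f x u = ∑ i, inner ℝ u (EuclideanSpace.single i (1 : ℝ)) *
      B (EuclideanSpace.single i (1 : ℝ)) u := fun u => by
    simp only [dirDeriv, iteratedFDeriv_two_apply]
    have hu := (EuclideanSpace.basisFun (Fin d) ℝ).sum_repr u
    conv_lhs => enter [1]; rw [← hu]
    rw [map_sum, sum_apply]
    refine Finset.sum_congr rfl fun i _ => ?_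
    simp [B, EuclideanSpace.inner_single_right]
  simp_rw [e]
  rw [integral_finsetSum]
  · simp_rw [integral_inner_mul_clm]
    rw [trHess_eq_sum]
    simp [dirDeriv, iteratedFDeriv_two_apply, B]
  · intro i _
    set L := B (EuclideanSpace.single i (1 : ℝ))
    refine integrable_of_le_pow (by fun_prop) ‖L‖ 2 fun u => ?_
    rw [norm_mul]
    calc _ ≤ (‖u‖ * 1) * (‖L‖ * ‖u‖) := by
          gcongr
          · exact (norm_inner_le_norm _ _).trans (by simp)
          · exact L.le_opNorm u
      _ = ‖L‖ * ‖u‖ ^ 2 := by ring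
      _ ≤ _ := by gcongr; simp

end Line

/-! ### The smoothed function and the two-point estimator -/

section Smoothing

variable {d : ℕ} {f : E d → ℝ} {L₁ L₂ L₃ lam : ℝ}

lemma SmoothOfOrder.norm_fderiv_le (hL : 0 ≤ L₁) (h : SmoothOfOrder 1 L₁ f) (x : E d) :
    ‖fderiv ℝ f x‖ ≤ (‖fderiv ℝ f 0‖ + L₁) * (1 + ‖x‖) := by
  refine ContinuousLinearMap.opNorm_le_bound _ (by positivity) fun v => ?_
  have h₁ := h.abs_fderiv_sub_le x 0 v
  have h₂ := (fderiv ℝ f 0).le_opNorm v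
  rw [sub_zero] at h₁
  rw [Real.norm_eq_abs] at *
  have h₃ : |fderiv ℝ f x v| ≤ |fderiv ℝ f x v - fderiv ℝ f 0 v| + |fderiv ℝ f 0 v| := by
    simpa using abs_add_le (fderiv ℝ f x v - fderiv ℝ f 0 v) (fderiv ℝ f 0 v)
  have : 0 ≤ ‖fderiv ℝ f 0‖ * ‖x‖ * ‖v‖ + L₁ * ‖v‖ := by positivity
  linarith

lemma SmoothOfOrder.abs_le (hL : 0 ≤ L₁) (h : SmoothOfOrder 1 L₁ f) (x : E d) :
    |f x| ≤ (|f 0| + ‖fderiv ℝ f 0‖ + L₁) * (1 + ‖x‖) ^ 2 := by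
  have h₁ := h.abs_sub_sub_fderiv_le 0 x
  have h₂ := (fderiv ℝ f 0).le_opNorm x
  rw [zero_add] at h₁
  rw [Real.norm_eq_abs] at h₂
  have h₃ : |f x| ≤ |f x - f 0 - fderiv ℝ f 0 x| + |f 0| + |fderiv ℝ f 0 x| := by
    have := abs_add_three (f x - f 0 - fderiv ℝ f 0 x) (f 0) (fderiv ℝ f 0 x)
    rwa [show f x - f 0 - fderiv ℝ f 0 x + f 0 + fderiv ℝ f 0 x = f x by ring] at this
  have e₁ : |f 0| ≤ |f 0| * (1 + ‖x‖) ^ 2 :=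
    le_mul_of_one_le_right (abs_nonneg _) (one_le_pow₀ (by simp))
  have e₂ : ‖fderiv ℝ f 0‖ * ‖x‖ ≤ ‖fderiv ℝ f 0‖ * (1 + ‖x‖) ^ 2 := by
    gcongr; nlinarith [norm_nonneg x]
  have e₃ : L₁ / 2 * ‖x‖ ^ 2 ≤ L₁ * (1 + ‖x‖) ^ 2 := by
    gcongr <;> simp [hL]
  linarith

lemma one_add_norm_add_smul_le (hl : 0 ≤ lam) (x u : E d) :
    1 + ‖x + lam • u‖ ≤ (1 + lam) * (1 + ‖x‖) * (1 + ‖u‖) := by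
  have h := norm_add_le x (lam • u)
  rw [norm_smul, Real.norm_of_nonneg hl] at h
  have : 0 ≤ ‖x‖ * ‖u‖ + lam + lam * ‖x‖ + lam * ‖x‖ * ‖u‖ + ‖u‖ := by positivity
  nlinarith

lemma integrable_comp_add_smul (hL : 0 ≤ L₁) (hl : 0 ≤ lam) (h : SmoothOfOrder 1 L₁ f) (x : E d) :
    Integrable (fun u => f (x + lam • u)) (stdGaussian (E d)) := by
  have hf := h.1.continuous
  refine integrable_of_le_pow (by fun_prop)
    ((|f 0| + ‖fderiv ℝ f 0‖ + L₁) * ((1 + lam) * (1 + ‖x‖)) ^ 2) 2 fun u => ?_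
  calc _ ≤ _ := h.abs_le hL _
    _ ≤ (|f 0| + ‖fderiv ℝ f 0‖ + L₁) * ((1 + lam) * (1 + ‖x‖) * (1 + ‖u‖)) ^ 2 := by
      gcongr; exact one_add_norm_add_smul_le hl x u
    _ = _ := by ring

lemma continuous_fderiv_apply (h : ContDiff ℝ 1 f) (v : E d) :
    Continuous fun x => fderiv ℝ f x v :=
  (h.continuous_fderiv one_ne_zero).clm_apply continuous_const

lemma integrable_fderiv_comp_add_smul (hL : 0 ≤ L₁) (hl : 0 ≤ lam) (h : SmoothOfOrder 1 L₁ f)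
    (x v : E d) :
    Integrable (fun u => fderiv ℝ f (x + lam • u) v) (stdGaussian (E d)) := by
  have hf := continuous_fderiv_apply h.1 v
  refine integrable_of_le_pow (hf.comp (by fun_prop : Continuous fun u : E d => x + lam • u))
    ((‖fderiv ℝ f 0‖ + L₁) * ((1 + lam) * (1 + ‖x‖)) * ‖v‖) 1 fun u => ?_
  calc _ ≤ _ := (fderiv ℝ f (x + lam • u)).le_opNorm v
    _ ≤ ((‖fderiv ℝ f 0‖ + L₁) * (1 + ‖x + lam • u‖)) * ‖v‖ := by
      gcongr; exact h.norm_fderiv_le hL _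
    _ ≤ ((‖fderiv ℝ f 0‖ + L₁) * ((1 + lam) * (1 + ‖x‖) * (1 + ‖u‖))) * ‖v‖ := by
      gcongr; exact one_add_norm_add_smul_le hl x u
    _ = _ := by ring

/-- The scalar factor of the two-point gradient estimator. -/
def centralSlope (f : E d → ℝ) (lam : ℝ) (x u : E d) : ℝ :=
  (f (x + lam • u) - f (x - lam • u)) / (2 * lam)

lemma twoPoint_eq (x u : E d) : twoPoint f lam x u = centralSlope f lam x u • u := rfl

lemma SmoothOfOrder.abs_centralSlope_sub_le (h : SmoothOfOrder 2 L₂ f) (hl : 0 < lam) (x u : E d) :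
    |centralSlope f lam x u - fderiv ℝ f x u| ≤ L₂ / 6 * lam ^ 2 * ‖u‖ ^ 3 := by
  have h₁ := h.abs_central_diff_le x u hl.le
  have e : centralSlope f lam x u - fderiv ℝ f x u =
      (f (x + lam • u) - f (x - lam • u) - 2 * lam * fderiv ℝ f x u) / (2 * lam) := by
    unfold centralSlope; field_simp
  rw [e, abs_div, abs_of_pos (by positivity : 0 < 2 * lam), div_le_iff₀ (by positivity)]
  refine h₁.trans (le_of_eq ?_)
  ring

lemma continuous_centralSlope (hf : Continuous f) :
    Continuous fun p : E d × E d => centralSlope f lam p.1 p.2 := by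
  unfold centralSlope; fun_prop

lemma continuous_twoPoint (hf : Continuous f) :
    Continuous fun p : E d × E d => twoPoint f lam p.1 p.2 := by
  unfold twoPoint; fun_prop

/-- Growth that is linear in `x` is what keeps the iterates square integrable. The quadratic growth
of `f` would not suffice, so the slope is compared with the directional derivative instead. -/
lemma exists_abs_centralSlope_le (hL : 0 ≤ L₁) (hL₂ : 0 ≤ L₂) (h₁ : SmoothOfOrder 1 L₁ f)
    (h₂ : SmoothOfOrder 2 L₂ f) (hl : 0 < lam) : ∃ K, 0 ≤ K ∧ ∀ x u : E d,
      |centralSlope f lam x u| ≤ K * (1 + ‖x‖) * (1 + ‖u‖) ^ 3 := by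
  refine ⟨(‖fderiv ℝ f 0‖ + L₁) + L₂ / 6 * lam ^ 2, by positivity, fun x u => ?_⟩
  have h₃ := h₂.abs_centralSlope_sub_le hl x u
  have h₄ : |fderiv ℝ f x u| ≤ (‖fderiv ℝ f 0‖ + L₁) * (1 + ‖x‖) * (1 + ‖u‖) ^ 3 :=
    calc _ ≤ _ := (fderiv ℝ f x).le_opNorm u
      _ ≤ ((‖fderiv ℝ f 0‖ + L₁) * (1 + ‖x‖)) * (1 + ‖u‖) ^ 3 := by
        gcongr
        · exact h₁.norm_fderiv_le hL x
        · calc ‖u‖ ≤ 1 + ‖u‖ := by simp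
            _ ≤ _ := le_self_pow₀ (by simp) (by norm_num)
  have h₅ : L₂ / 6 * lam ^ 2 * ‖u‖ ^ 3 ≤ L₂ / 6 * lam ^ 2 * (1 + ‖x‖) * (1 + ‖u‖) ^ 3 := by
    have h₇ : L₂ / 6 * lam ^ 2 ≤ L₂ / 6 * lam ^ 2 * (1 + ‖x‖) :=
      le_mul_of_one_le_right (by positivity) (by simp)
    have h₈ : ‖u‖ ^ 3 ≤ (1 + ‖u‖) ^ 3 := by gcongr; simp
    exact mul_le_mul h₇ h₈ (by positivity) (by positivity)
  have h₆ : |centralSlope f lam x u| ≤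
      |centralSlope f lam x u - fderiv ℝ f x u| + |fderiv ℝ f x u| := by
    simpa using abs_add_le (centralSlope f lam x u - fderiv ℝ f x u) (fderiv ℝ f x u)
  linarith

lemma exists_norm_twoPoint_le (hL : 0 ≤ L₁) (hL₂ : 0 ≤ L₂) (h₁ : SmoothOfOrder 1 L₁ f)
    (h₂ : SmoothOfOrder 2 L₂ f) (hl : 0 < lam) : ∃ K, 0 ≤ K ∧ ∀ x u : E d,
      ‖twoPoint f lam x u‖ ≤ K * (1 + ‖x‖) * (1 + ‖u‖) ^ 4 := by
  obtain ⟨K, hK, h⟩ := exists_abs_centralSlope_le hL hL₂ h₁ h₂ hl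
  refine ⟨K, hK, fun x u => ?_⟩
  rw [twoPoint_eq, norm_smul, Real.norm_eq_abs]
  calc _ ≤ (K * (1 + ‖x‖) * (1 + ‖u‖) ^ 3) * (1 + ‖u‖) := by
        gcongr
        · exact h x u
        · simp
    _ = _ := by ring

lemma integrable_twoPoint (hL : 0 ≤ L₁) (hL₂ : 0 ≤ L₂) (h₁ : SmoothOfOrder 1 L₁ f)
    (h₂ : SmoothOfOrder 2 L₂ f) (hl : 0 < lam) (x : E d) :
    Integrable (twoPoint f lam x) (stdGaussian (E d)) := by
  obtain ⟨K, hK, h⟩ := exists_norm_twoPoint_le hL hL₂ h₁ h₂ hl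
  exact integrable_of_le_pow ((continuous_twoPoint h₁.1.continuous).comp
    (by fun_prop : Continuous fun u : E d => (x, u))) (K * (1 + ‖x‖)) 4 (h x)

lemma integrable_norm_twoPoint_sq (hL : 0 ≤ L₁) (hL₂ : 0 ≤ L₂) (h₁ : SmoothOfOrder 1 L₁ f)
    (h₂ : SmoothOfOrder 2 L₂ f) (hl : 0 < lam) (x : E d) :
    Integrable (fun u => ‖twoPoint f lam x u‖ ^ 2) (stdGaussian (E d)) := by
  obtain ⟨K, hK, h⟩ := exists_norm_twoPoint_le hL hL₂ h₁ h₂ hl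
  refine integrable_of_le_pow (((continuous_twoPoint h₁.1.continuous).comp
    (by fun_prop : Continuous fun u : E d => (x, u))).norm.pow 2)
    ((K * (1 + ‖x‖)) ^ 2) 8 fun u => ?_
  rw [Real.norm_of_nonneg (by positivity)]
  calc _ ≤ (K * (1 + ‖x‖) * (1 + ‖u‖) ^ 4) ^ 2 := by gcongr; exact h x u
    _ = _ := by ring

lemma fderiv_eq_inner_gradient (x u : E d) : fderiv ℝ f x u = inner ℝ u (gradient f x) := by
  rw [real_inner_comm, gradient, InnerProductSpace.toDual_symm_apply]

lemma norm_gradient (x : E d) : ‖gradient f x‖ = ‖fderiv ℝ f x‖ := by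
  rw [gradient, LinearIsometryEquiv.norm_map]

/-- Second moment of the two-point gradient estimator. -/
lemma integral_norm_twoPoint_sq_le (hL : 0 ≤ L₁) (hL₂ : 0 ≤ L₂) (h₁ : SmoothOfOrder 1 L₁ f)
    (h₂ : SmoothOfOrder 2 L₂ f) (hl : 0 < lam) (x : E d) :
    ∫ u, ‖twoPoint f lam x u‖ ^ 2 ∂(stdGaussian (E d)) ≤
      2 * (d + 2) * ‖fderiv ℝ f x‖ ^ 2 +
        L₂ ^ 2 / 18 * lam ^ 4 * (d * (d + 2) * (d + 4) * (d + 6)) := by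
  have hp : ∀ u, ‖twoPoint f lam x u‖ ^ 2 ≤
      2 * (inner ℝ u (gradient f x) ^ 2 * ‖u‖ ^ 2) + L₂ ^ 2 / 18 * lam ^ 4 * ‖u‖ ^ 8 := fun u => by
    rw [twoPoint_eq, norm_smul, mul_pow, Real.norm_eq_abs, sq_abs, ← fderiv_eq_inner_gradient]
    have h₃ := h₂.abs_centralSlope_sub_le hl x u
    have h₄ := pow_le_pow_left₀ (abs_nonneg _) h₃ 2
    rw [sq_abs] at h₄
    -- `s² ≤ 2a² + 2(s - a)²` is `0 ≤ (s - 2a)²`.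
    have h₅ : centralSlope f lam x u ^ 2 ≤
        2 * fderiv ℝ f x u ^ 2 + 2 * (L₂ / 6 * lam ^ 2 * ‖u‖ ^ 3) ^ 2 := by
      nlinarith [sq_nonneg (centralSlope f lam x u - 2 * fderiv ℝ f x u)]
    calc _ ≤ (2 * fderiv ℝ f x u ^ 2 + 2 * (L₂ / 6 * lam ^ 2 * ‖u‖ ^ 3) ^ 2) * ‖u‖ ^ 2 := by gcongr
      _ = _ := by ring
  have i₁ : Integrable (fun u : E d => inner ℝ u (gradient f x) ^ 2 * ‖u‖ ^ 2)
      (stdGaussian (E d)) := by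
    simpa using integrable_inner_sq_mul_norm_pow (gradient f x) 1
  have i₂ := integrable_norm_pow_stdGaussian (V := E d) 8
  refine (integral_mono (integrable_norm_twoPoint_sq hL hL₂ h₁ h₂ hl x)
    ((i₁.const_mul 2).add (i₂.const_mul _)) hp).trans (le_of_eq ?_)
  simp only [Pi.add_apply]
  rw [integral_add (i₁.const_mul 2) (i₂.const_mul _), integral_const_mul, integral_const_mul,
    integral_inner_sq_mul_norm_sq, integral_norm_pow_eight, norm_gradient]
  simp only [finrank_euclideanSpace, Fintype.card_fin]
  ring

/-- The mean of the two-point gradient estimator. -/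
def meanTwoPoint (f : E d → ℝ) (lam : ℝ) (x : E d) : E d :=
  ∫ u, twoPoint f lam x u ∂(stdGaussian (E d))

lemma inner_meanTwoPoint (hL : 0 ≤ L₁) (hL₂ : 0 ≤ L₂) (h₁ : SmoothOfOrder 1 L₁ f)
    (h₂ : SmoothOfOrder 2 L₂ f) (hl : 0 < lam) (x v : E d) :
    inner ℝ v (meanTwoPoint f lam x) =
      ∫ u, inner ℝ v (twoPoint f lam x u) ∂(stdGaussian (E d)) :=
  (integral_inner (integrable_twoPoint hL hL₂ h₁ h₂ hl x) v).symm

lemma integrable_inner_mul_comp (hL : 0 ≤ L₁) (hl : 0 ≤ lam) (h : SmoothOfOrder 1 L₁ f)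
    (x v : E d) :
    Integrable (fun u => inner ℝ u v * f (x + lam • u)) (stdGaussian (E d)) := by
  have hf := h.1.continuous
  refine integrable_of_le_pow (by fun_prop)
    (‖v‖ * ((|f 0| + ‖fderiv ℝ f 0‖ + L₁) * ((1 + lam) * (1 + ‖x‖)) ^ 2)) 3 fun u => ?_
  rw [norm_mul]
  calc _ ≤ ((1 + ‖u‖) * ‖v‖) * ((|f 0| + ‖fderiv ℝ f 0‖ + L₁) * (1 + ‖x + lam • u‖) ^ 2) := by
        gcongr
        · refine (norm_inner_le_norm _ _).trans ?_
          gcongr; simp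
        · exact h.abs_le hL _
    _ ≤ ((1 + ‖u‖) * ‖v‖) * ((|f 0| + ‖fderiv ℝ f 0‖ + L₁) *
        ((1 + lam) * (1 + ‖x‖) * (1 + ‖u‖)) ^ 2) := by
      gcongr; exact one_add_norm_add_smul_le hl x u
    _ = _ := by ring

/-- The two-point estimator is unbiased for the gradient of the smoothed function. -/
lemma inner_meanTwoPoint_eq_integral_fderiv (hL : 0 ≤ L₁) (hL₂ : 0 ≤ L₂)
    (h₁ : SmoothOfOrder 1 L₁ f) (h₂ : SmoothOfOrder 2 L₂ f) (hl : 0 < lam) (x v : E d) :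
    inner ℝ v (meanTwoPoint f lam x) =
      ∫ u, fderiv ℝ f (x + lam • u) v ∂(stdGaussian (E d)) := by
  have hd : ∀ u : E d, HasFDerivAt (fun u => f (x + lam • u))
      (lam • fderiv ℝ f (x + lam • u)) u := fun u => by
    have h₃ : HasFDerivAt (fun u : E d => x + lam • u)
        (lam • ContinuousLinearMap.id ℝ (E d)) u :=
      ((hasFDerivAt_id u).const_smul lam).const_add x
    refine ((h₁.1.differentiable one_ne_zero (x + lam • u)).hasFDerivAt.comp u h₃).congr_fderiv ?_
    ext w; simp
  have i₀ := integrable_inner_mul_comp hL hl.le h₁ x v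
  have hst := stein v hd (integrable_comp_add_smul hL hl.le h₁ x)
    (by simpa using (integrable_fderiv_comp_add_smul hL hl.le h₁ x v).const_mul lam) i₀
  simp only [smul_apply, smul_eq_mul] at hst
  rw [integral_const_mul] at hst
  have hneg := integral_comp_neg_stdGaussian (V := E d) fun u => inner ℝ u v * f (x + lam • u)
  -- The reflected term is the forward term minus `2λ` times the central slope, so its integrability
  -- follows from that of the other two.
  have hin : Integrable (fun u => inner ℝ u v * f (x - lam • u)) (stdGaussian (E d)) := by
    obtain ⟨K, hK, h⟩ := exists_abs_centralSlope_le hL hL₂ h₁ h₂ hl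
    have : Integrable (fun u => inner ℝ u v * centralSlope f lam x u) (stdGaussian (E d)) := by
      refine integrable_of_le_pow ((by fun_prop : Continuous fun u : E d => inner ℝ u v).mul
        ((continuous_centralSlope h₁.1.continuous).comp
          (by fun_prop : Continuous fun u : E d => (x, u)))) (‖v‖ * (K * (1 + ‖x‖))) 4 fun u => ?_
      rw [norm_mul]
      calc _ ≤ ((1 + ‖u‖) * ‖v‖) * (K * (1 + ‖x‖) * (1 + ‖u‖) ^ 3) := by
            gcongr
            · refine (norm_inner_le_norm _ _).trans ?_
              gcongr; simp
            · exact h x u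
        _ = _ := by ring
    refine (i₀.sub (this.const_mul (2 * lam))).congr (.of_forall fun u => ?_)
    simp only [centralSlope, Pi.sub_apply]
    field_simp
    ring
  -- By the symmetry of the Gaussian both halves of the estimator contribute equally, and Stein's
  -- identity evaluates either one.
  have hneg' : ∫ u, inner ℝ u v * f (x - lam • u) ∂(stdGaussian (E d)) =
      -∫ u, inner ℝ u v * f (x + lam • u) ∂(stdGaussian (E d)) := by
    rw [← hneg, ← integral_neg]
    congr 1; ext u
    simp [sub_eq_add_neg]
  rw [inner_meanTwoPoint hL hL₂ h₁ h₂ hl]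
  have e : ∀ u, inner ℝ v (twoPoint f lam x u) = (2 * lam)⁻¹ *
      (inner ℝ u v * f (x + lam • u) - inner ℝ u v * f (x - lam • u)) := fun u => by
    rw [twoPoint, inner_smul_right, real_inner_comm]; field_simp
  simp_rw [e]
  rw [integral_const_mul, integral_sub i₀ hin, hneg', hst]
  field_simp
  ring

/-- Since `𝔼⟨∇f, u⟩u = ∇f`, the bias `G - ∇f` is the mean of the slope error times `u`, of norm at
most `(L₂/6) λ² ‖u‖⁴`; and `𝔼‖u‖⁴ = d(d+2)`. -/
lemma norm_fderiv_le_norm_meanTwoPoint (hL : 0 ≤ L₁) (hL₂ : 0 ≤ L₂)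
    (h₁ : SmoothOfOrder 1 L₁ f) (h₂ : SmoothOfOrder 2 L₂ f) (hl : 0 < lam) (x : E d) :
    ‖fderiv ℝ f x‖ ≤ ‖meanTwoPoint f lam x‖ + L₂ / 6 * lam ^ 2 * (d * (d + 2)) := by
  refine ContinuousLinearMap.opNorm_le_bound _ (by positivity) fun v => ?_
  have hi : Integrable (fun u => inner ℝ v (twoPoint f lam x u)) (stdGaussian (E d)) :=
    (integrable_twoPoint hL hL₂ h₁ h₂ hl x).const_inner v
  have hi' : Integrable (fun u => inner ℝ u v * fderiv ℝ f x u) (stdGaussian (E d)) := by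
    refine integrable_of_le_pow (by fun_prop) (‖v‖ * ‖fderiv ℝ f x‖) 2 fun u => ?_
    rw [norm_mul]
    calc _ ≤ (‖u‖ * ‖v‖) * (‖fderiv ℝ f x‖ * ‖u‖) := by
          gcongr
          · exact norm_inner_le_norm _ _
          · exact (fderiv ℝ f x).le_opNorm u
      _ = ‖v‖ * ‖fderiv ℝ f x‖ * ‖u‖ ^ 2 := by ring
      _ ≤ _ := by gcongr; simp
  have hb : |inner ℝ v (meanTwoPoint f lam x) - fderiv ℝ f x v| ≤
      L₂ / 6 * lam ^ 2 * (d * (d + 2)) * ‖v‖ := by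
    rw [inner_meanTwoPoint hL hL₂ h₁ h₂ hl, ← integral_inner_mul_clm, ← integral_sub hi hi',
      ← Real.norm_eq_abs]
    refine (norm_integral_le_of_norm_le
      (((integrable_norm_pow_stdGaussian (V := E d) 4).const_mul
        (L₂ / 6 * lam ^ 2 * ‖v‖))) (.of_forall fun u => ?_)).trans (le_of_eq ?_)
    · rw [twoPoint_eq, inner_smul_right, real_inner_comm, mul_comm, ← mul_sub, norm_mul]
      calc _ ≤ (‖u‖ * ‖v‖) * (L₂ / 6 * lam ^ 2 * ‖u‖ ^ 3) := by
            gcongr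
            · exact norm_inner_le_norm _ _
            · exact h₂.abs_centralSlope_sub_le hl x u
        _ = _ := by ring
    · rw [integral_const_mul, integral_norm_pow_four, finrank_euclideanSpace, Fintype.card_fin]
      ring
  have hc := abs_real_inner_le_norm v (meanTwoPoint f lam x)
  rw [Real.norm_eq_abs]
  have := abs_sub_abs_le_abs_sub (fderiv ℝ f x v) (inner ℝ v (meanTwoPoint f lam x))
  rw [abs_sub_comm] at this
  linarith

lemma integrable_smoothed_taylor (hL : 0 ≤ L₁) (hl : 0 ≤ lam) (h : SmoothOfOrder 1 L₁ f)
    (x v : E d) :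
    Integrable (fun u => f (x + lam • u) + fderiv ℝ f (x + lam • u) v) (stdGaussian (E d)) :=
  (integrable_comp_add_smul hL hl h x).add (integrable_fderiv_comp_add_smul hL hl h x v)

/-- The linearization of `f_λ` is the average of the linearizations of `f`, so first-order
inequalities may be proved under the integral. -/
lemma smoothed_add_inner (hL : 0 ≤ L₁) (hL₂ : 0 ≤ L₂)
    (h₁ : SmoothOfOrder 1 L₁ f) (h₂ : SmoothOfOrder 2 L₂ f) (hl : 0 < lam) (x v : E d) :
    smoothed f lam x + inner ℝ v (meanTwoPoint f lam x) =
      ∫ u, (f (x + lam • u) + fderiv ℝ f (x + lam • u) v) ∂(stdGaussian (E d)) := by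
  rw [inner_meanTwoPoint_eq_integral_fderiv hL hL₂ h₁ h₂ hl, smoothed, integral_add
    (integrable_comp_add_smul hL hl.le h₁ x) (integrable_fderiv_comp_add_smul hL hl.le h₁ x v)]

/-- Gradient inequality for the smoothed function. -/
lemma smoothed_add_inner_le (hL : 0 ≤ L₁) (hL₂ : 0 ≤ L₂)
    (h₁ : SmoothOfOrder 1 L₁ f) (h₂ : SmoothOfOrder 2 L₂ f) (hc : ConvexOn ℝ Set.univ f)
    (hl : 0 < lam) (x v : E d) :
    smoothed f lam x + inner ℝ v (meanTwoPoint f lam x) ≤ smoothed f lam (x + v) := by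
  rw [smoothed_add_inner hL hL₂ h₁ h₂ hl]
  refine integral_mono (integrable_smoothed_taylor hL hl.le h₁ x v)
    (integrable_comp_add_smul hL hl.le h₁ (x + v)) fun u => ?_
  have := convex_fderiv_le (h₁.1.differentiable one_ne_zero) hc (x + lam • u) (x + v + lam • u)
  rwa [show x + v + lam • u - (x + lam • u) = v by abel] at this

/-- Descent inequality for the smoothed function. -/
lemma smoothed_le_add_inner (hL : 0 ≤ L₁) (hL₂ : 0 ≤ L₂)
    (h₁ : SmoothOfOrder 1 L₁ f) (h₂ : SmoothOfOrder 2 L₂ f) (hl : 0 < lam) (x v : E d) :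
    smoothed f lam (x + v) ≤
      smoothed f lam x + inner ℝ v (meanTwoPoint f lam x) + L₁ / 2 * ‖v‖ ^ 2 := by
  rw [smoothed_add_inner hL hL₂ h₁ h₂ hl]
  have : L₁ / 2 * ‖v‖ ^ 2 = ∫ _u : E d, L₁ / 2 * ‖v‖ ^ 2 ∂(stdGaussian (E d)) := by simp
  rw [this, ← integral_add (integrable_smoothed_taylor hL hl.le h₁ x v) (integrable_const _)]
  refine integral_mono (integrable_comp_add_smul hL hl.le h₁ (x + v))
    ((integrable_smoothed_taylor hL hl.le h₁ x v).add (integrable_const _)) fun u => ?_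
  have := (le_abs_self _).trans (h₁.abs_sub_sub_fderiv_le (x + lam • u) v)
  rw [show x + lam • u + v = x + v + lam • u by abel] at this
  linarith

/-- A gradient step `-G/L₁` decreases `f_λ` by at least `‖G‖²/(2L₁)`, and it cannot go below the
minimum. -/
lemma norm_meanTwoPoint_sq_le (hL : 0 < L₁) (hL₂ : 0 ≤ L₂)
    (h₁ : SmoothOfOrder 1 L₁ f) (h₂ : SmoothOfOrder 2 L₂ f) (hl : 0 < lam) {z : E d}
    (hz : z ∈ argmin (smoothed f lam)) (x : E d) :
    ‖meanTwoPoint f lam x‖ ^ 2 ≤ 2 * L₁ * (smoothed f lam x - smoothed f lam z) := by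
  have h := smoothed_le_add_inner hL.le hL₂ h₁ h₂ hl x (-(L₁⁻¹ • meanTwoPoint f lam x))
  have h' := hz (x + -(L₁⁻¹ • meanTwoPoint f lam x))
  rw [inner_neg_left, real_inner_smul_left, real_inner_self_eq_norm_sq, norm_neg, norm_smul,
    Real.norm_of_nonneg (by positivity)] at h
  have e : smoothed f lam x + -(L₁⁻¹ * ‖meanTwoPoint f lam x‖ ^ 2) +
      L₁ / 2 * (L₁⁻¹ * ‖meanTwoPoint f lam x‖) ^ 2 =
      smoothed f lam x - ‖meanTwoPoint f lam x‖ ^ 2 / (2 * L₁) := by field_simp; ring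
  rw [e] at h
  have : ‖meanTwoPoint f lam x‖ ^ 2 / (2 * L₁) ≤ smoothed f lam x - smoothed f lam z := by linarith
  rw [div_le_iff₀ (by positivity)] at this
  linarith

/-- The gradient inequality at `w = a x + b y`, weighted by `a` and `b`: the linear terms cancel. -/
lemma convexOn_smoothed (hL : 0 ≤ L₁) (hL₂ : 0 ≤ L₂)
    (h₁ : SmoothOfOrder 1 L₁ f) (h₂ : SmoothOfOrder 2 L₂ f) (hc : ConvexOn ℝ Set.univ f)
    (hl : 0 < lam) : ConvexOn ℝ Set.univ (smoothed f lam) := by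
  refine ⟨convex_univ, fun x _ y _ a b ha hb hab => ?_⟩
  set w := a • x + b • y
  have hx := smoothed_add_inner_le hL hL₂ h₁ h₂ hc hl w (x - w)
  have hy := smoothed_add_inner_le hL hL₂ h₁ h₂ hc hl w (y - w)
  rw [add_sub_cancel] at hx hy
  have e : a * inner ℝ (x - w) (meanTwoPoint f lam w) +
      b * inner ℝ (y - w) (meanTwoPoint f lam w) = 0 := by
    rw [← real_inner_smul_left, ← real_inner_smul_left, ← inner_add_left]
    have : a • (x - w) + b • (y - w) = 0 := by
      rw [smul_sub, smul_sub, sub_add_sub_comm, ← add_smul, hab, one_smul, sub_self]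
    rw [this, inner_zero_left]
  have := add_le_add (mul_le_mul_of_nonneg_left hx ha) (mul_le_mul_of_nonneg_left hy hb)
  simp only [smul_eq_mul]
  have e₂ : a * smoothed f lam w + b * smoothed f lam w = smoothed f lam w := by
    rw [← add_mul, hab, one_mul]
  linarith

/-- The first-order inequalities at `0` trap `f_λ` between an affine and a quadratic function, so it
is integrable along square-integrable iterates. -/
lemma exists_abs_smoothed_le (hL : 0 ≤ L₁) (hL₂ : 0 ≤ L₂)
    (h₁ : SmoothOfOrder 1 L₁ f) (h₂ : SmoothOfOrder 2 L₂ f) (hc : ConvexOn ℝ Set.univ f)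
    (hl : 0 < lam) : ∃ K, 0 ≤ K ∧ ∀ x, |smoothed f lam x| ≤ K * (1 + ‖x‖) ^ 2 := by
  refine ⟨|smoothed f lam 0| + ‖meanTwoPoint f lam 0‖ + L₁, by positivity, fun x => ?_⟩
  have hlo := smoothed_add_inner_le hL hL₂ h₁ h₂ hc hl 0 x
  have hup := smoothed_le_add_inner hL hL₂ h₁ h₂ hl 0 x
  rw [zero_add] at hlo hup
  have hi := abs_le.1 (abs_real_inner_le_norm x (meanTwoPoint f lam 0))
  have h0 := abs_le.1 (le_refl |smoothed f lam 0|)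
  have e₁ : |smoothed f lam 0| ≤ |smoothed f lam 0| * (1 + ‖x‖) ^ 2 :=
    le_mul_of_one_le_right (abs_nonneg _) (one_le_pow₀ (by simp))
  have e₂ : ‖x‖ * ‖meanTwoPoint f lam 0‖ ≤ ‖meanTwoPoint f lam 0‖ * (1 + ‖x‖) ^ 2 := by
    rw [mul_comm]; gcongr; nlinarith [norm_nonneg x]
  have e₃ : L₁ / 2 * ‖x‖ ^ 2 ≤ L₁ * (1 + ‖x‖) ^ 2 := by
    gcongr <;> simp [hL]
  have e₄ : 0 ≤ L₁ * (1 + ‖x‖) ^ 2 := by positivity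
  rw [abs_le]
  constructor <;> linarith

lemma continuous_smoothed (hL : 0 ≤ L₁) (hL₂ : 0 ≤ L₂)
    (h₁ : SmoothOfOrder 1 L₁ f) (h₂ : SmoothOfOrder 2 L₂ f) (hc : ConvexOn ℝ Set.univ f)
    (hl : 0 < lam) : Continuous (smoothed f lam) :=
  continuousOn_univ.1 ((convexOn_smoothed hL hL₂ h₁ h₂ hc hl).continuousOn isOpen_univ)

/-- The smoothed function is close to the trace-regularized loss. -/
lemma abs_smoothed_sub_regLoss_le (hL : 0 ≤ L₁) (hL₃ : 0 ≤ L₃) (h₁ : SmoothOfOrder 1 L₁ f)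
    (h₃ : SmoothOfOrder 3 L₃ f) (hl : 0 < lam) (x : E d) :
    |smoothed f lam x - regLoss f lam x| ≤ L₃ / 24 * lam ^ 4 * (d + 4) ^ 2 := by
  have hi := integrable_comp_add_smul hL hl.le h₁ x
  have hneg := integral_comp_neg_stdGaussian (V := E d) fun u => f (x + lam • u)
  simp only [smul_neg, ← sub_eq_add_neg] at hneg
  have hi' : Integrable (fun u => f (x - lam • u)) (stdGaussian (E d)) := by
    have hf := h₁.1.continuous
    refine integrable_of_le_pow (by fun_prop)
      ((|f 0| + ‖fderiv ℝ f 0‖ + L₁) * ((1 + lam) * (1 + ‖x‖)) ^ 2) 2 fun u => ?_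
    calc _ ≤ _ := h₁.abs_le hL _
      _ ≤ (|f 0| + ‖fderiv ℝ f 0‖ + L₁) * ((1 + lam) * (1 + ‖x‖) * (1 + ‖u‖)) ^ 2 := by
        gcongr
        simpa [sub_eq_add_neg] using one_add_norm_add_smul_le hl.le x (-u)
      _ = _ := by ring
  have hD : Integrable (fun u => dirDeriv 2 f x u) (stdGaussian (E d)) := by
    refine integrable_of_le_pow (continuous_dirDeriv 2 x) L₁ 2 fun u => ?_
    refine (h₁.abs_dirDeriv_two_le hL (h₃.1.of_le (by norm_num)) x u).trans ?_
    gcongr; simp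
  -- Averaging `f_λ` over `u` and `-u` brings in the even difference, and the mean of `∇²f(x)[u]²`
  -- is the trace.
  have e : smoothed f lam x - regLoss f lam x = ∫ u, ((f (x + lam • u) + f (x - lam • u)) / 2
      - f x - lam ^ 2 / 2 * dirDeriv 2 f x u) ∂(stdGaussian (E d)) := by
    have hs : Integrable (fun u => (f (x + lam • u) + f (x - lam • u)) / 2)
        (stdGaussian (E d)) := (hi.add hi').div_const 2
    have hs' : Integrable (fun u => (f (x + lam • u) + f (x - lam • u)) / 2 - f x)
        (stdGaussian (E d)) := hs.sub (integrable_const _)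
    rw [integral_sub hs' (hD.const_mul _), integral_sub hs (integrable_const _), integral_div,
      integral_add hi hi', hneg, integral_const_mul, integral_dirDeriv_two]
    simp [smoothed, regLoss]
    ring
  rw [e, ← Real.norm_eq_abs]
  refine (norm_integral_le_of_norm_le
      (((integrable_norm_pow_stdGaussian (V := E d) 4).const_mul
        (L₃ / 24 * lam ^ 4))) (.of_forall fun u => h₃.abs_second_diff_le x u hl.le)).trans ?_
  rw [integral_const_mul, integral_norm_pow_four, finrank_euclideanSpace, Fintype.card_fin]
  gcongr
  have : (0 : ℝ) ≤ d := by positivity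
  nlinarith

end Smoothing

/-! ### One descent step from a fixed point -/

section Descent

variable {d : ℕ} {f : E d → ℝ} {L₁ L₂ L₃ lam : ℝ}

/-- The contribution of the estimator noise to the squared distance, per squared stepsize. -/
def noiseBound (d : ℕ) (L₂ lam : ℝ) : ℝ :=
  4 * (d + 2) * (L₂ / 6 * lam ^ 2 * (d * (d + 2))) ^ 2 +
    L₂ ^ 2 / 18 * lam ^ 4 * (d * (d + 2) * (d + 4) * (d + 6))

lemma stepsize_pos (hL : 0 < L₁) : 0 < stepsize d L₁ := by
  unfold stepsize; positivity

lemma stepsize_mul_noiseBound_le (hL : 0 < L₁) :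
    stepsize d L₁ * noiseBound d L₂ lam ≤ L₂ ^ 2 / (12 * L₁) * lam ^ 4 * ((d : ℝ) + 8) ^ 4 := by
  have hd : (0 : ℝ) ≤ d := by positivity
  have e : stepsize d L₁ * noiseBound d L₂ lam = L₂ ^ 2 / (12 * L₁) * lam ^ 4 *
      ((d : ℝ) ^ 2 * (d + 2) ^ 2 / 6 + d * (d + 4) * (d + 6) / 12) := by
    unfold stepsize noiseBound
    field_simp
    ring
  rw [e]
  gcongr
  have h₁ : (d : ℝ) ^ 2 * (d + 2) ^ 2 ≤ (d + 8) ^ 4 := by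
    calc (d : ℝ) ^ 2 * (d + 2) ^ 2 ≤ (d + 8) ^ 2 * (d + 8) ^ 2 := by gcongr <;> linarith
      _ = _ := by ring
  have h₂ : (d : ℝ) * (d + 4) * (d + 6) ≤ (d + 8) ^ 4 := by
    calc (d : ℝ) * (d + 4) * (d + 6) ≤ (d + 8) * (d + 8) * (d + 8) := by gcongr <;> linarith
      _ = (d + 8) ^ 3 := by ring
      _ ≤ _ := by gcongr <;> linarith
  linarith [show (0 : ℝ) ≤ (d + 8) ^ 4 by positivity]

/-- One step of zeroth-order descent from a fixed point. -/
lemma integral_norm_step_sq_le (hL : 0 < L₁) (hL₂ : 0 ≤ L₂)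
    (h₁ : SmoothOfOrder 1 L₁ f) (h₂ : SmoothOfOrder 2 L₂ f) (hc : ConvexOn ℝ Set.univ f)
    (hl : 0 < lam) {z : E d} (hz : z ∈ argmin (smoothed f lam)) (x : E d) :
    ∫ u, ‖x - stepsize d L₁ • twoPoint f lam x u - z‖ ^ 2 ∂(stdGaussian (E d)) ≤
      ‖x - z‖ ^ 2 - stepsize d L₁ * (smoothed f lam x - smoothed f lam z)
        + stepsize d L₁ ^ 2 * noiseBound d L₂ lam := by
  set η := stepsize d L₁ with hη
  have hη0 : 0 < η := stepsize_pos hL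
  have ig := integrable_twoPoint hL.le hL₂ h₁ h₂ hl x
  have ig2 := integrable_norm_twoPoint_sq hL.le hL₂ h₁ h₂ hl x
  have ii : Integrable (fun u => inner ℝ (x - z) (twoPoint f lam x u)) (stdGaussian (E d)) :=
    ig.const_inner _
  have e : ∀ u, ‖x - η • twoPoint f lam x u - z‖ ^ 2 = ‖x - z‖ ^ 2 -
      2 * η * inner ℝ (x - z) (twoPoint f lam x u) + η ^ 2 * ‖twoPoint f lam x u‖ ^ 2 := fun u => by
    rw [sub_right_comm, norm_sub_sq_real, inner_smul_right, norm_smul, mul_pow,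
      Real.norm_eq_abs, sq_abs]
    ring
  simp_rw [e]
  have i₃ : Integrable (fun u => ‖x - z‖ ^ 2 -
      2 * η * inner ℝ (x - z) (twoPoint f lam x u)) (stdGaussian (E d)) :=
    (integrable_const _).sub (ii.const_mul _)
  rw [integral_add i₃ (ig2.const_mul _), integral_sub (integrable_const _) (ii.const_mul _),
    integral_const_mul, integral_const_mul, ← inner_meanTwoPoint hL.le hL₂ h₁ h₂ hl]
  simp only [integral_const, probReal_univ, one_smul]
  have hlin := smoothed_add_inner_le hL.le hL₂ h₁ h₂ hc hl x (z - x)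
  rw [add_sub_cancel, ← neg_sub x z, inner_neg_left] at hlin
  have hG := norm_meanTwoPoint_sq_le hL hL₂ h₁ h₂ hl hz x
  have hD := norm_fderiv_le_norm_meanTwoPoint hL.le hL₂ h₁ h₂ hl x
  have hM := integral_norm_twoPoint_sq_le hL.le hL₂ h₁ h₂ hl x
  set Δ := smoothed f lam x - smoothed f lam z
  set b := L₂ / 6 * lam ^ 2 * (d * ((d : ℝ) + 2))
  have hD2 : ‖fderiv ℝ f x‖ ^ 2 ≤ 2 * ‖meanTwoPoint f lam x‖ ^ 2 + 2 * b ^ 2 := by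
    have := pow_le_pow_left₀ (norm_nonneg _) hD 2
    nlinarith [sq_nonneg (‖meanTwoPoint f lam x‖ - b)]
  -- The factor `8` is `2` from the second moment, `2` from `(a + b)² ≤ 2a² + 2b²` and `2` from
  -- `‖G‖² ≤ 2L₁Δ`.
  have hM' : ∫ u, ‖twoPoint f lam x u‖ ^ 2 ∂(stdGaussian (E d)) ≤
      8 * (d + 2) * L₁ * Δ + noiseBound d L₂ lam := by
    have h₄ : ‖fderiv ℝ f x‖ ^ 2 ≤ 2 * (2 * L₁ * Δ) + 2 * b ^ 2 := by linarith
    have h₅ : 2 * ((d : ℝ) + 2) * ‖fderiv ℝ f x‖ ^ 2 ≤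
        2 * (d + 2) * (2 * (2 * L₁ * Δ) + 2 * b ^ 2) := by gcongr
    refine hM.trans ((add_le_add_left h₅ _).trans (le_of_eq ?_))
    unfold noiseBound
    ring
  -- This fixes the stepsize: the noise proportional to the gap becomes `ηΔ`, half of the drift
  -- `2ηΔ`.
  have hη1 : η * (8 * (d + 2) * L₁) = 1 := by
    rw [hη, stepsize]; field_simp
  have h₆ : η ^ 2 * ∫ u, ‖twoPoint f lam x u‖ ^ 2 ∂(stdGaussian (E d)) ≤
      η * Δ + η ^ 2 * noiseBound d L₂ lam := by
    calc _ ≤ η ^ 2 * (8 * (d + 2) * L₁ * Δ + noiseBound d L₂ lam) := by gcongr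
      _ = η * (η * (8 * (d + 2) * L₁)) * Δ + η ^ 2 * noiseBound d L₂ lam := by ring
      _ = _ := by rw [hη1, mul_one]
  have h₇ : 2 * η * Δ ≤ 2 * η * inner ℝ (x - z) (meanTwoPoint f lam x) := by
    gcongr
    simp only [Δ]
    linarith
  linarith

end Descent

/-! ### Random iterates: integrability, independence, telescoping -/

section Random

variable {d : ℕ} {f : E d → ℝ} {L₁ L₂ L₃ lam : ℝ} {Ω : Type*} [MeasurableSpace Ω]
  {P : Measure Ω} [IsProbabilityMeasure P]

lemma integrable_one_add_norm_sq {X : Ω → E d} (hX : MemLp X 2 P) :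
    Integrable (fun ω => (1 + ‖X ω‖) ^ 2) P :=
  ((memLp_const (1 : ℝ)).add hX.norm).integrable_sq

lemma integrable_comp_of_le_sq {X : Ω → E d} (hX : MemLp X 2 P) {h : E d → ℝ} (hc : Continuous h)
    {C : ℝ} (hb : ∀ x, |h x| ≤ C * (1 + ‖x‖) ^ 2) : Integrable (fun ω => h (X ω)) P :=
  ((integrable_one_add_norm_sq hX).const_mul C).mono'
    (hc.comp_aestronglyMeasurable hX.1) (.of_forall fun ω => hb (X ω))

/-- The square is dominated by a multiple of `(1 + ‖x‖)² (1 + ‖u‖)⁸`, whose factors are integrable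
separately. -/
lemma integrable_prod_step_sq (hL : 0 ≤ L₁) (hL₂ : 0 ≤ L₂)
    (h₁ : SmoothOfOrder 1 L₁ f) (h₂ : SmoothOfOrder 2 L₂ f) (hl : 0 < lam) (η : ℝ) (z : E d)
    {X : Ω → E d} (hX : MemLp X 2 P) :
    Integrable (fun p : E d × E d => ‖p.1 - η • twoPoint f lam p.1 p.2 - z‖ ^ 2)
      ((P.map X).prod (stdGaussian (E d))) := by
  obtain ⟨K, hK, h⟩ := exists_norm_twoPoint_le hL hL₂ h₁ h₂ hl
  have hXm := hX.1.aemeasurable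
  have : IsProbabilityMeasure (P.map X) := Measure.isProbabilityMeasure_map hXm
  have i₁ : Integrable (fun x : E d => (1 + ‖x‖) ^ 2) (P.map X) :=
    (integrable_map_measure (by fun_prop) hXm).2 (integrable_one_add_norm_sq hX)
  have i₂ : Integrable (fun u : E d => (1 + ‖u‖) ^ 8) (stdGaussian (E d)) :=
    integrable_of_le_pow (by fun_prop) 1 8 fun u => by
      rw [Real.norm_of_nonneg (by positivity), one_mul]
  have hg := continuous_twoPoint (lam := lam) h₁.1.continuous
  refine ((i₁.mul_prod i₂).const_mul ((1 + |η| * K + ‖z‖) ^ 2)).mono'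
    (by fun_prop) (.of_forall fun p => ?_)
  rw [Real.norm_of_nonneg (by positivity)]
  have hp : ‖p.1 - η • twoPoint f lam p.1 p.2 - z‖ ≤
      (1 + |η| * K + ‖z‖) * ((1 + ‖p.1‖) * (1 + ‖p.2‖) ^ 4) := by
    have hu : 1 ≤ (1 + ‖p.2‖) ^ 4 := one_le_pow₀ (by simp)
    have hx : 1 ≤ 1 + ‖p.1‖ := by simp
    have hxu : 1 ≤ (1 + ‖p.1‖) * (1 + ‖p.2‖) ^ 4 := one_le_mul_of_one_le_of_one_le hx hu
    have e₁ : ‖p.1‖ ≤ (1 + ‖p.1‖) * (1 + ‖p.2‖) ^ 4 :=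
      (by simp : ‖p.1‖ ≤ 1 + ‖p.1‖).trans (le_mul_of_one_le_right (by positivity) hu)
    have e₂ : ‖z‖ ≤ ‖z‖ * ((1 + ‖p.1‖) * (1 + ‖p.2‖) ^ 4) :=
      le_mul_of_one_le_right (norm_nonneg _) hxu
    have e₃ : |η| * ‖twoPoint f lam p.1 p.2‖ ≤ |η| * (K * (1 + ‖p.1‖) * (1 + ‖p.2‖) ^ 4) := by
      gcongr; exact h _ _
    calc _ ≤ ‖p.1‖ + |η| * ‖twoPoint f lam p.1 p.2‖ + ‖z‖ := by
          refine (norm_sub_le _ _).trans ?_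
          gcongr
          refine (norm_sub_le _ _).trans ?_
          rw [norm_smul, Real.norm_eq_abs]
      _ ≤ _ := by linarith
  calc _ ≤ ((1 + |η| * K + ‖z‖) * ((1 + ‖p.1‖) * (1 + ‖p.2‖) ^ 4)) ^ 2 := by gcongr
    _ = _ := by ring

lemma map_prodMk_eq {X U : Ω → E d} (hX : AEMeasurable X P)
    (hU : HasLaw U (stdGaussian (E d)) P) (hXU : IndepFun X U P) :
    P.map (fun ω => (X ω, U ω)) = (P.map X).prod (stdGaussian (E d)) := by
  rw [(indepFun_iff_map_prod_eq_prod_map_map hX hU.aemeasurable).1 hXU, hU.map_eq]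

lemma integrable_step_sq (hL : 0 ≤ L₁) (hL₂ : 0 ≤ L₂)
    (h₁ : SmoothOfOrder 1 L₁ f) (h₂ : SmoothOfOrder 2 L₂ f) (hl : 0 < lam) (η : ℝ) (z : E d)
    {X U : Ω → E d} (hX : MemLp X 2 P) (hU : HasLaw U (stdGaussian (E d)) P)
    (hXU : IndepFun X U P) :
    Integrable (fun ω => ‖X ω - η • twoPoint f lam (X ω) (U ω) - z‖ ^ 2) P := by
  have hp := integrable_prod_step_sq hL hL₂ h₁ h₂ hl η z hX
  rw [← map_prodMk_eq hX.1.aemeasurable hU hXU] at hp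
  exact hp.comp_aemeasurable (hX.1.aemeasurable.prodMk hU.aemeasurable)

lemma memLp_step (hL : 0 ≤ L₁) (hL₂ : 0 ≤ L₂)
    (h₁ : SmoothOfOrder 1 L₁ f) (h₂ : SmoothOfOrder 2 L₂ f) (hl : 0 < lam) (η : ℝ)
    {X U : Ω → E d} (hX : MemLp X 2 P) (hU : HasLaw U (stdGaussian (E d)) P)
    (hXU : IndepFun X U P) :
    MemLp (fun ω => X ω - η • twoPoint f lam (X ω) (U ω)) 2 P := by
  have hm : AEStronglyMeasurable (fun ω => X ω - η • twoPoint f lam (X ω) (U ω)) P :=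
    (continuous_fst.sub ((continuous_twoPoint (lam := lam) h₁.1.continuous).const_smul
      η)).comp_aestronglyMeasurable (hX.1.prodMk hU.aemeasurable.aestronglyMeasurable)
  rw [memLp_two_iff_integrable_sq_norm hm]
  simpa using integrable_step_sq hL hL₂ h₁ h₂ hl η 0 hX hU hXU

/-- One step of zeroth-order descent from a random point independent of the direction. -/
lemma integral_step_sq_le (hL : 0 < L₁) (hL₂ : 0 ≤ L₂)
    (h₁ : SmoothOfOrder 1 L₁ f) (h₂ : SmoothOfOrder 2 L₂ f) (hc : ConvexOn ℝ Set.univ f)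
    (hl : 0 < lam) {z : E d} (hz : z ∈ argmin (smoothed f lam))
    {X U : Ω → E d} (hX : MemLp X 2 P) (hU : HasLaw U (stdGaussian (E d)) P)
    (hXU : IndepFun X U P) :
    ∫ ω, ‖X ω - stepsize d L₁ • twoPoint f lam (X ω) (U ω) - z‖ ^ 2 ∂P ≤
      ∫ ω, ‖X ω - z‖ ^ 2 ∂P - stepsize d L₁ * ∫ ω, (smoothed f lam (X ω) - smoothed f lam z) ∂P
        + stepsize d L₁ ^ 2 * noiseBound d L₂ lam := by
  set η := stepsize d L₁
  have hXm := hX.1.aemeasurable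
  have hprob : IsProbabilityMeasure (P.map X) := Measure.isProbabilityMeasure_map hXm
  have hp := integrable_prod_step_sq hL.le hL₂ h₁ h₂ hl η z hX
  have hmap := map_prodMk_eq hXm hU hXU
  have hpair := hXm.prodMk hU.aemeasurable
  -- By independence the joint law is a product, so Fubini replaces conditioning on `X`.
  have e : ∫ ω, ‖X ω - η • twoPoint f lam (X ω) (U ω) - z‖ ^ 2 ∂P =
      ∫ ω, (∫ u, ‖X ω - η • twoPoint f lam (X ω) u - z‖ ^ 2 ∂(stdGaussian (E d))) ∂P := by
    have h₃ := integral_map hpair (f := fun p : E d × E d =>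
      ‖p.1 - η • twoPoint f lam p.1 p.2 - z‖ ^ 2) (by rw [hmap]; exact hp.1)
    rw [← h₃, hmap, integral_prod _ hp,
      integral_map hXm hp.integral_prod_left.aestronglyMeasurable]
  have i₁ : Integrable
      (fun ω => ∫ u, ‖X ω - η • twoPoint f lam (X ω) u - z‖ ^ 2 ∂(stdGaussian (E d))) P :=
    hp.integral_prod_left.comp_aemeasurable hXm
  have i₂ : Integrable (fun ω => ‖X ω - z‖ ^ 2) P :=
    (hX.sub (memLp_const z)).integrable_norm_pow two_ne_zero
  obtain ⟨K, -, hK⟩ := exists_abs_smoothed_le hL.le hL₂ h₁ h₂ hc hl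
  have i₃ : Integrable (fun ω => smoothed f lam (X ω) - smoothed f lam z) P :=
    (integrable_comp_of_le_sq hX (continuous_smoothed hL.le hL₂ h₁ h₂ hc hl) hK).sub
      (integrable_const _)
  have i₄ : Integrable (fun ω => ‖X ω - z‖ ^ 2 -
      η * (smoothed f lam (X ω) - smoothed f lam z)) P := i₂.sub (i₃.const_mul η)
  rw [e]
  refine (integral_mono i₁ (i₄.add (integrable_const _)) fun ω =>
    integral_norm_step_sq_le hL hL₂ h₁ h₂ hc hl hz (X ω)).trans (le_of_eq ?_)
  simp only [Pi.add_apply]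
  rw [integral_add i₄ (integrable_const _), integral_sub i₂ (i₃.const_mul η), integral_const_mul]
  simp [η]

/-- The process is adapted: this is the source of the independence of `x_t` and `u_t`. -/
lemma iterate_congr {η : ℝ} {x₀ : E d} {v w : ℕ → E d} {t : ℕ} (h : ∀ i < t, v i = w i) :
    iterate f η lam x₀ v t = iterate f η lam x₀ w t := by
  induction t with
  | zero => rfl
  | succ t ih =>
    simp only [iterate]
    rw [ih fun i hi => h i (hi.trans t.lt_succ_self), h t t.lt_succ_self]

lemma continuous_iterate (hf : Continuous f) (η : ℝ) (x₀ : E d) (t : ℕ) :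
    Continuous fun v : ℕ → E d => iterate f η lam x₀ v t := by
  induction t with
  | zero => exact continuous_const
  | succ t ih =>
    exact ih.sub (((continuous_twoPoint hf).comp (ih.prodMk (continuous_apply t))).const_smul η)

omit [IsProbabilityMeasure P] in
/-- The current iterate is independent of the next search direction. -/
lemma IsGaussianDirections.indepFun_iterate {u : ℕ → Ω → E d} (hu : IsGaussianDirections P u)
    (hf : Continuous f) (η : ℝ) (x₀ : E d) (t : ℕ) :
    IndepFun (fun ω => iterate f η lam x₀ (fun s => u s ω) t) (u t) P := by
  have h := hu.indep.indepFun_finset₀ (Finset.range t) {t} (by simp)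
    fun i => (hu.hasLaw i).aemeasurable
  -- Extending by `0` exhibits `x_t` as a measurable function of the finite tuple of the first `t`
  -- directions.
  let ext : (Finset.range t → E d) → ℕ → E d := fun w i =>
    if hi : i ∈ Finset.range t then w ⟨i, hi⟩ else 0
  have hext : Measurable ext := by
    refine measurable_pi_iff.2 fun i => ?_
    by_cases hi : i ∈ Finset.range t
    · simp only [ext, hi, dite_true]; fun_prop
    · simp only [ext, hi, dite_false]; fun_prop
  have := h.comp ((continuous_iterate (lam := lam) hf η x₀ t).measurable.comp hext)
    (measurable_pi_apply (⟨t, Finset.mem_singleton_self t⟩ : ({t} : Finset ℕ)))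
  refine this.congr (.of_forall fun ω => ?_) (.of_forall fun ω => rfl)
  refine iterate_congr fun i hi => ?_
  simp [ext, hi]

lemma IsGaussianDirections.memLp_iterate (hL : 0 ≤ L₁) (hL₂ : 0 ≤ L₂)
    (h₁ : SmoothOfOrder 1 L₁ f) (h₂ : SmoothOfOrder 2 L₂ f) (hl : 0 < lam) (η : ℝ) (x₀ : E d)
    {u : ℕ → Ω → E d} (hu : IsGaussianDirections P u) (t : ℕ) :
    MemLp (fun ω => iterate f η lam x₀ (fun s => u s ω) t) 2 P := by
  induction t with
  | zero => exact memLp_const x₀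
  | succ t ih =>
    exact memLp_step hL hL₂ h₁ h₂ hl η ih (hu.hasLaw t)
      (hu.indepFun_iterate h₁.1.continuous η x₀ t)

lemma IsGaussianDirections.memLp_avgIterate (hL : 0 ≤ L₁) (hL₂ : 0 ≤ L₂)
    (h₁ : SmoothOfOrder 1 L₁ f) (h₂ : SmoothOfOrder 2 L₂ f) (hl : 0 < lam) (η : ℝ) (x₀ : E d)
    {u : ℕ → Ω → E d} (hu : IsGaussianDirections P u) (T : ℕ) :
    MemLp (fun ω => avgIterate f η lam x₀ (fun s => u s ω) T) 2 P :=
  (memLp_finsetSum _ fun t _ => hu.memLp_iterate hL hL₂ h₁ h₂ hl η x₀ t).const_smul (1 / (T : ℝ))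

lemma IsGaussianDirections.integrable_smoothed_iterate (hL : 0 ≤ L₁) (hL₂ : 0 ≤ L₂)
    (h₁ : SmoothOfOrder 1 L₁ f) (h₂ : SmoothOfOrder 2 L₂ f) (hc : ConvexOn ℝ Set.univ f)
    (hl : 0 < lam) (η : ℝ) (x₀ : E d) {u : ℕ → Ω → E d} (hu : IsGaussianDirections P u) (t : ℕ) :
    Integrable (fun ω => smoothed f lam (iterate f η lam x₀ (fun s => u s ω) t)) P := by
  obtain ⟨K, -, hK⟩ := exists_abs_smoothed_le hL hL₂ h₁ h₂ hc hl
  exact integrable_comp_of_le_sq (hu.memLp_iterate hL hL₂ h₁ h₂ hl η x₀ t)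
    (continuous_smoothed hL hL₂ h₁ h₂ hc hl) hK

/-- Telescoped descent inequality. -/
lemma IsGaussianDirections.sum_integral_smoothed_le (hL : 0 < L₁) (hL₂ : 0 ≤ L₂)
    (h₁ : SmoothOfOrder 1 L₁ f) (h₂ : SmoothOfOrder 2 L₂ f) (hc : ConvexOn ℝ Set.univ f)
    (hl : 0 < lam) {z : E d} (hz : z ∈ argmin (smoothed f lam)) (x₀ : E d)
    {u : ℕ → Ω → E d} (hu : IsGaussianDirections P u) (T : ℕ) :
    ∫ ω, ‖iterate f (stepsize d L₁) lam x₀ (fun s => u s ω) T - z‖ ^ 2 ∂P +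
      stepsize d L₁ * ∑ t ∈ Finset.range T, ∫ ω, (smoothed f lam
        (iterate f (stepsize d L₁) lam x₀ (fun s => u s ω) t) - smoothed f lam z) ∂P ≤
      ‖x₀ - z‖ ^ 2 + T * (stepsize d L₁ ^ 2 * noiseBound d L₂ lam) := by
  induction T with
  | zero => simp [iterate]
  | succ T ih =>
    have h := integral_step_sq_le hL hL₂ h₁ h₂ hc hl hz
      (hu.memLp_iterate hL.le hL₂ h₁ h₂ hl (stepsize d L₁) x₀ T) (hu.hasLaw T)
      (hu.indepFun_iterate h₁.1.continuous _ x₀ T)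
    rw [Finset.sum_range_succ, mul_add]
    simp only [iterate]
    push_cast
    linarith

/-- Convergence of the averaged iterate on the smoothed function. -/
lemma IsGaussianDirections.integral_smoothed_avgIterate_le (hL : 0 < L₁) (hL₂ : 0 ≤ L₂)
    (h₁ : SmoothOfOrder 1 L₁ f) (h₂ : SmoothOfOrder 2 L₂ f) (hc : ConvexOn ℝ Set.univ f)
    (hl : 0 < lam) {z : E d} (hz : z ∈ argmin (smoothed f lam)) (x₀ : E d)
    {u : ℕ → Ω → E d} (hu : IsGaussianDirections P u) {T : ℕ} (hT : 1 ≤ T) :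
    Integrable (fun ω => smoothed f lam
      (avgIterate f (stepsize d L₁) lam x₀ (fun s => u s ω) T)) P ∧
    ∫ ω, (smoothed f lam (avgIterate f (stepsize d L₁) lam x₀ (fun s => u s ω) T) -
        smoothed f lam z) ∂P ≤ 8 * ((d : ℝ) + 2) * L₁ * ‖x₀ - z‖ ^ 2 / T
          + L₂ ^ 2 / (12 * L₁) * lam ^ 4 * ((d : ℝ) + 8) ^ 4 := by
  obtain ⟨K, -, hK⟩ := exists_abs_smoothed_le hL.le hL₂ h₁ h₂ hc hl
  have hint := integrable_comp_of_le_sq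
    (hu.memLp_avgIterate hL.le hL₂ h₁ h₂ hl (stepsize d L₁) x₀ T)
    (continuous_smoothed hL.le hL₂ h₁ h₂ hc hl) hK
  refine ⟨hint, ?_⟩
  have hT0 : (0 : ℝ) < T := by exact_mod_cast hT
  have hη0 := stepsize_pos (d := d) hL
  have hiter := fun t => hu.integrable_smoothed_iterate hL.le hL₂ h₁ h₂ hc hl (stepsize d L₁) x₀ t
  -- Jensen's inequality for the uniform weights `1/T`.
  have hpt : ∀ ω, smoothed f lam (avgIterate f (stepsize d L₁) lam x₀ (fun s => u s ω) T) -
      smoothed f lam z ≤ (1 / (T : ℝ)) * ∑ t ∈ Finset.range T, (smoothed f lam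
        (iterate f (stepsize d L₁) lam x₀ (fun s => u s ω) t) - smoothed f lam z) := fun ω => by
    have h := (convexOn_smoothed hL.le hL₂ h₁ h₂ hc hl).map_sum_le (t := Finset.range T)
      (w := fun _ => 1 / (T : ℝ)) (p := fun t => iterate f (stepsize d L₁) lam x₀ (fun s => u s ω) t)
      (fun _ _ => by positivity) (by simp [hT0.ne']) (fun _ _ => Set.mem_univ _)
    rw [← Finset.smul_sum] at h
    simp only [smul_eq_mul] at h
    rw [← Finset.mul_sum] at h
    rw [avgIterate, Finset.sum_sub_distrib, mul_sub]
    simp only [Finset.sum_const, Finset.card_range, nsmul_eq_mul]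
    rw [← mul_assoc, one_div_mul_cancel hT0.ne', one_mul]
    linarith
  have hsum := hu.sum_integral_smoothed_le hL hL₂ h₁ h₂ hc hl hz x₀ T
  have hnn : 0 ≤ ∫ ω, ‖iterate f (stepsize d L₁) lam x₀ (fun s => u s ω) T - z‖ ^ 2 ∂P :=
    integral_nonneg fun _ => by positivity
  have hmono := integral_mono (hint.sub (integrable_const (smoothed f lam z)))
    ((integrable_finsetSum (Finset.range T) fun t _ =>
      (hiter t).sub (integrable_const (smoothed f lam z))).const_mul (1 / (T : ℝ))) hpt
  refine hmono.trans ?_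
  rw [integral_const_mul, integral_finsetSum _ fun t _ => (hiter t).sub (integrable_const _)]
  simp only [Pi.sub_apply]
  set S := ∑ t ∈ Finset.range T, ∫ ω, (smoothed f lam
        (iterate f (stepsize d L₁) lam x₀ (fun s => u s ω) t) - smoothed f lam z) ∂P
  have hS : stepsize d L₁ * S ≤
      ‖x₀ - z‖ ^ 2 + T * (stepsize d L₁ ^ 2 * noiseBound d L₂ lam) := by linarith
  have hη1 : stepsize d L₁ * (8 * (d + 2) * L₁) = 1 := by
    rw [stepsize]; field_simp
  have hS' : S ≤ 8 * (d + 2) * L₁ * ‖x₀ - z‖ ^ 2 +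
      T * (stepsize d L₁ * noiseBound d L₂ lam) := by
    refine le_of_mul_le_mul_left (hS.trans (le_of_eq ?_)) hη0
    linear_combination (-‖x₀ - z‖ ^ 2) * hη1
  calc 1 / (T : ℝ) * S ≤ 1 / (T : ℝ) * (8 * (d + 2) * L₁ * ‖x₀ - z‖ ^ 2 +
        T * (stepsize d L₁ * noiseBound d L₂ lam)) := by gcongr
    _ = 8 * ((d : ℝ) + 2) * L₁ * ‖x₀ - z‖ ^ 2 / T + stepsize d L₁ * noiseBound d L₂ lam := by
      field_simp
    _ ≤ _ := add_le_add_right (stepsize_mul_noiseBound_le hL) _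

end Random

/-! ### From the smoothed function to approximate flat minima -/

section Main

variable {d : ℕ} {f : E d → ℝ} {L₁ L₂ L₃ lam : ℝ} {Ω : Type*} [MeasurableSpace Ω]
  {P : Measure Ω} [IsProbabilityMeasure P]

lemma integrable_loss_comp (hL : 0 ≤ L₁) (hs : SmoothnessAssumption L₁ L₂ L₃ f) {X : Ω → E d}
    (hX : MemLp X 2 P) : Integrable (fun ω => f (X ω)) P :=
  integrable_comp_of_le_sq hX hs.contDiff.continuous (hs.first.abs_le hL)

lemma integrable_trHess_comp (hL : 0 ≤ L₁) (hs : SmoothnessAssumption L₁ L₂ L₃ f)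
    (hc : ConvexOn ℝ Set.univ f) {X : Ω → E d} (hX : MemLp X 2 P) :
    Integrable (fun ω => trHess f (X ω)) P := by
  refine integrable_comp_of_le_sq hX (continuous_trHess hs.second.1) (C := d * L₁) fun x => ?_
  rw [abs_of_nonneg (trHess_nonneg hs.second.1 hc x)]
  exact (hs.first.trHess_le hL hs.second.1 x).trans
    (le_mul_of_one_le_right (by positivity) (one_le_pow₀ (by simp)))

/-- Convergence of the averaged iterate on the trace-regularized loss. -/
theorem regLoss_avgIterate (hL : 0 < L₁) (hL₂ : 0 ≤ L₂) (hL₃ : 0 ≤ L₃)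
    (hs : SmoothnessAssumption L₁ L₂ L₃ f) (hc : ConvexOn ℝ Set.univ f)
    (hl : 0 < lam) {z : E d} (hz : z ∈ argmin (smoothed f lam)) (x₀ : E d)
    {u : ℕ → Ω → E d} (hu : IsGaussianDirections P u) {T : ℕ} (hT : 1 ≤ T) :
    BddBelow (Set.range (regLoss f lam)) ∧
    Integrable (fun ω => regLoss f lam
      (avgIterate f (stepsize d L₁) lam x₀ (fun t => u t ω) T)) P ∧
    ∫ ω, (regLoss f lam (avgIterate f (stepsize d L₁) lam x₀ (fun t => u t ω) T)
        - ⨅ x, regLoss f lam x) ∂P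
      ≤ 8 * ((d : ℝ) + 2) * L₁ * ‖x₀ - z‖ ^ 2 / T
        + L₂ ^ 2 / (12 * L₁) * lam ^ 4 * ((d : ℝ) + 8) ^ 4
        + L₃ / 12 * lam ^ 4 * ((d : ℝ) + 4) ^ 2 := by
  set c := L₃ / 24 * lam ^ 4 * ((d : ℝ) + 4) ^ 2 with hcdef
  have hclose := fun x => abs_le.1 (abs_smoothed_sub_regLoss_le hL.le hL₃ hs.first hs.third hl x)
  have hlow : ∀ x, smoothed f lam z - c ≤ regLoss f lam x := fun x => by
    have h₁ := (hclose x).2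
    have h₂ := hz x
    linarith
  have hX := hu.memLp_avgIterate hL.le hL₂ hs.first hs.second hl (stepsize d L₁) x₀ T
  have hF : Integrable (fun ω => regLoss f lam
      (avgIterate f (stepsize d L₁) lam x₀ (fun t => u t ω) T)) P :=
    (integrable_loss_comp hL.le hs hX).add
      ((integrable_trHess_comp hL.le hs hc hX).const_mul (lam ^ 2 / 2))
  refine ⟨⟨smoothed f lam z - c, Set.forall_mem_range.2 hlow⟩, hF, ?_⟩
  obtain ⟨hi, hb⟩ := hu.integral_smoothed_avgIterate_le hL hL₂ hs.first hs.second hc hl hz x₀ hT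
  have hi' : Integrable (fun ω => smoothed f lam (avgIterate f (stepsize d L₁) lam x₀
      (fun t => u t ω) T) - smoothed f lam z) P := hi.sub (integrable_const _)
  -- The comparison error `c` is paid twice, for the infimum here and for the averaged iterate
  -- below; hence `L₃/12` instead of `L₃/24`.
  have hinf : smoothed f lam z - c ≤ ⨅ x, regLoss f lam x := le_ciInf hlow
  have hmono := integral_mono (hF.sub (integrable_const (⨅ x, regLoss f lam x)))
    (hi'.add (integrable_const (2 * c))) fun ω => by
      have := (hclose (avgIterate f (stepsize d L₁) lam x₀ (fun t => u t ω) T)).1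
      simp only [Pi.sub_apply, Pi.add_apply]
      linarith
  simp only [Pi.sub_apply, Pi.add_apply] at hmono
  rw [integral_add hi' (integrable_const _)] at hmono
  simp only [integral_const, probReal_univ, one_smul] at hmono
  have : 2 * c = L₃ / 12 * lam ^ 4 * ((d : ℝ) + 4) ^ 2 := by rw [hcdef]; ring
  linarith

lemma iInf_eq_of_mem_argmin {z : E d} (hz : z ∈ argmin f) : ⨅ x, f x = f z :=
  le_antisymm (ciInf_le ⟨f z, Set.forall_mem_range.2 hz⟩ z) (le_ciInf hz)

lemma lamSq_pos {ε : ℝ} (hL₁ : 0 < L₁) (hL₂ : 0 < L₂) (hL₃ : 0 < L₃) (hε : 0 < ε) :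
    0 < lamSq d L₁ L₂ L₃ ε := by
  unfold lamSq
  exact lt_min (by positivity) (by positivity)

/-- The entries of the maximum are the reciprocals of the entries of the minimum defining `lamSq`.
-/
lemma one_le_lamSq_mul_max {ε : ℝ} (hL₁ : 0 < L₁) (hL₂ : 0 < L₂) (hL₃ : 0 < L₃) (hε : 0 < ε) :
    1 ≤ lamSq d L₁ L₂ L₃ ε *
      max (L₃ * ((d : ℝ) + 4) ^ 2 / (2 * ε)) (L₂ ^ 2 * ((d : ℝ) + 8) ^ 4 / (2 * L₁ * ε)) := by
  have hp := (lamSq_pos (d := d) hL₁ hL₂ hL₃ hε).le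
  unfold lamSq at *
  set M := max (L₃ * ((d : ℝ) + 4) ^ 2 / (2 * ε)) (L₂ ^ 2 * ((d : ℝ) + 8) ^ 4 / (2 * L₁ * ε))
  rcases min_choice (2 * ε / (L₃ * ((d : ℝ) + 4) ^ 2))
    (2 * L₁ * ε / (L₂ ^ 2 * ((d : ℝ) + 8) ^ 4)) with h | h
  · calc (1 : ℝ) = 2 * ε / (L₃ * ((d : ℝ) + 4) ^ 2) * (L₃ * ((d : ℝ) + 4) ^ 2 / (2 * ε)) := by
          field_simp
      _ ≤ _ := by rw [h]; gcongr; exact le_max_left _ _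
  · calc (1 : ℝ) = 2 * L₁ * ε / (L₂ ^ 2 * ((d : ℝ) + 8) ^ 4) *
          (L₂ ^ 2 * ((d : ℝ) + 8) ^ 4 / (2 * L₁ * ε)) := by field_simp
      _ ≤ _ := by rw [h]; gcongr; exact le_max_right _ _

/-- With the prescribed parameters the bound on the regularized loss is `λ² ε / 2`. -/
lemma regLoss_bound_le {ε R : ℝ} (hL₁ : 0 < L₁) (hL₂ : 0 < L₂) (hL₃ : 0 < L₃) (hε : 0 < ε)
    (hlam : lam ^ 2 = lamSq d L₁ L₂ L₃ ε) {T : ℕ} (hT : 1 ≤ T)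
    (hT' : iterBound d L₁ L₂ L₃ ε R ≤ T) :
    8 * ((d : ℝ) + 2) * L₁ * R ^ 2 / T
      + L₂ ^ 2 / (12 * L₁) * lam ^ 4 * ((d : ℝ) + 8) ^ 4
      + L₃ / 12 * lam ^ 4 * ((d : ℝ) + 4) ^ 2 ≤ lam ^ 2 / 2 * ε := by
  have hT0 : (0 : ℝ) < T := by exact_mod_cast hT
  have hM := one_le_lamSq_mul_max (d := d) hL₁ hL₂ hL₃ hε
  rw [← hlam] at hM
  have ha : lam ^ 2 ≤ 2 * ε / (L₃ * ((d : ℝ) + 4) ^ 2) := hlam.trans_le (min_le_left _ _)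
  have hb : lam ^ 2 ≤ 2 * L₁ * ε / (L₂ ^ 2 * ((d : ℝ) + 8) ^ 4) := hlam.trans_le (min_le_right _ _)
  rw [le_div_iff₀ (by positivity)] at ha hb
  unfold iterBound at hT'
  set M := max (L₃ * ((d : ℝ) + 4) ^ 2 / (2 * ε)) (L₂ ^ 2 * ((d : ℝ) + 8) ^ 4 / (2 * L₁ * ε))
  -- Each of the three terms gets a third of `λ²ε/2`; the `48` in `iterBound` is `6 · 8`.
  have e₁ : 8 * ((d : ℝ) + 2) * L₁ * R ^ 2 / T ≤ lam ^ 2 * ε / 6 := by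
    rw [div_le_iff₀ hT0]
    calc 8 * ((d : ℝ) + 2) * L₁ * R ^ 2 = 8 * ((d : ℝ) + 2) * L₁ * R ^ 2 * 1 := by ring
      _ ≤ 8 * ((d : ℝ) + 2) * L₁ * R ^ 2 * (lam ^ 2 * M) := by gcongr
      _ = lam ^ 2 * ε / 6 * (48 * ((d : ℝ) + 2) * L₁ * R ^ 2 / ε * M) := by field_simp; ring
      _ ≤ _ := by gcongr
  have e₂ : L₂ ^ 2 / (12 * L₁) * lam ^ 4 * ((d : ℝ) + 8) ^ 4 ≤ lam ^ 2 * ε / 6 := by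
    calc _ = lam ^ 2 / (12 * L₁) * (lam ^ 2 * (L₂ ^ 2 * ((d : ℝ) + 8) ^ 4)) := by ring
      _ ≤ lam ^ 2 / (12 * L₁) * (2 * L₁ * ε) := by gcongr
      _ = _ := by field_simp; ring
  have e₃ : L₃ / 12 * lam ^ 4 * ((d : ℝ) + 4) ^ 2 ≤ lam ^ 2 * ε / 6 := by
    calc _ = lam ^ 2 / 12 * (lam ^ 2 * (L₃ * ((d : ℝ) + 4) ^ 2)) := by ring
      _ ≤ lam ^ 2 / 12 * (2 * ε) := by gcongr
      _ = _ := by ring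
  linarith

/-- With the prescribed parameters the averaged iterate is an approximate flat minimum. -/
theorem isApproxFlatMin_avgIterate {ε : ℝ} (hL₁ : 0 < L₁) (hL₂ : 0 < L₂) (hL₃ : 0 < L₃)
    (hs : SmoothnessAssumption L₁ L₂ L₃ f) (hc : ConvexOn ℝ Set.univ f)
    (hne : (argmin f).Nonempty) (hε : 0 < ε)
    (hl : 0 < lam) (hlam : lam ^ 2 = lamSq d L₁ L₂ L₃ ε)
    {z : E d} (hz : z ∈ argmin (smoothed f lam)) (x₀ : E d)
    {u : ℕ → Ω → E d} (hu : IsGaussianDirections P u) {T : ℕ} (hT : 1 ≤ T)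
    (hT' : iterBound d L₁ L₂ L₃ ε ‖x₀ - z‖ ≤ T) :
    IsApproxFlatMinInExpectation P f
      (L₁ ^ 2 * ε / (L₂ ^ 2 * ((d : ℝ) + 8) ^ 3) * (1 + ε / (L₁ * ((d : ℝ) + 8)))) ε
      (fun ω => avgIterate f (stepsize d L₁) lam x₀ (fun t => u t ω) T) := by
  obtain ⟨hbdd, hF, hmain⟩ := regLoss_avgIterate hL₁ hL₂.le hL₃.le hs hc hl hz x₀ hu hT
  have hX := hu.memLp_avgIterate hL₁.le hL₂.le hs.first hs.second hl (stepsize d L₁) x₀ T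
  set X := fun ω => avgIterate f (stepsize d L₁) lam x₀ (fun t => u t ω) T
  have hf := integrable_loss_comp hL₁.le hs hX
  have htr := integrable_trHess_comp hL₁.le hs hc hX
  obtain ⟨y, hy⟩ := hne
  have hne' : Nonempty (argmin f) := ⟨⟨y, hy⟩⟩
  have hm := iInf_eq_of_mem_argmin hy
  set m := ⨅ x, f x
  set τ := ⨅ x : argmin f, trHess f x
  have hl2 : 0 < lam ^ 2 / 2 := by positivity
  have hτ : τ ≤ d * L₁ :=
    (ciInf_le (f := fun x : argmin f => trHess f x)
      ⟨0, Set.forall_mem_range.2 fun x => trHess_nonneg hs.second.1 hc x⟩ ⟨y, hy⟩).trans (hs.first.trHess_le hL₁.le hs.second.1 y)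
  -- At a minimizer of `f` the value of `F` is `m` plus `λ²/2` times the trace. Solving for the
  -- trace before taking the infimum avoids assuming that `τ` is attained.
  have hinf : (⨅ x, regLoss f lam x) ≤ m + lam ^ 2 / 2 * τ := by
    have : ((⨅ x, regLoss f lam x) - m) / (lam ^ 2 / 2) ≤ τ := le_ciInf fun x => by
      rw [div_le_iff₀ hl2]
      have h₁ := ciInf_le hbdd x.1
      have h₂ : m = f x.1 := iInf_eq_of_mem_argmin x.2
      rw [regLoss] at h₁
      linarith
    rw [div_le_iff₀ hl2] at this
    linarith
  have hIf : m ≤ ∫ ω, f (X ω) ∂P := by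
    have := integral_mono (integrable_const m) hf fun ω => hm.trans_le (hy (X ω))
    simpa using this
  have hIt : 0 ≤ ∫ ω, trHess f (X ω) ∂P :=
    integral_nonneg fun ω => trHess_nonneg hs.second.1 hc (X ω)
  have hkey : (∫ ω, f (X ω) ∂P - m) + lam ^ 2 / 2 * (∫ ω, trHess f (X ω) ∂P - τ) ≤
      lam ^ 2 / 2 * ε := by
    have h := hmain.trans (regLoss_bound_le hL₁ hL₂ hL₃ hε hlam hT hT')
    rw [integral_sub hF (integrable_const _)] at h
    simp only [regLoss] at h
    rw [integral_add hf (htr.const_mul _), integral_const_mul] at h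
    simp only [integral_const, probReal_univ, one_smul] at h
    simp only [regLoss] at hinf
    linarith
  refine ⟨hf, ?_, htr, ?_⟩
  · rw [integral_sub hf (integrable_const _)]
    simp only [integral_const, probReal_univ, one_smul]
    -- For the loss the trace gap is bounded below by `-τ ≥ -d L₁`; only the second entry of the
    -- minimum is needed for `λ²`.
    have hb : lam ^ 2 ≤ 2 * L₁ * ε / (L₂ ^ 2 * ((d : ℝ) + 8) ^ 4) :=
      hlam.trans_le (min_le_right _ _)
    have hd : (d : ℝ) * L₁ ≤ L₁ * (d + 8) := by linarith
    have h₁ : lam ^ 2 / 2 * τ ≤ lam ^ 2 / 2 * (L₁ * (d + 8)) := by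
      gcongr; exact hτ.trans hd
    have h₂ : lam ^ 2 / 2 * 0 ≤ lam ^ 2 / 2 * ∫ ω, trHess f (X ω) ∂P := by gcongr
    calc ∫ ω, f (X ω) ∂P - m ≤ lam ^ 2 / 2 * (ε + L₁ * (d + 8)) := by linarith
      _ ≤ 2 * L₁ * ε / (L₂ ^ 2 * ((d : ℝ) + 8) ^ 4) / 2 * (ε + L₁ * (d + 8)) := by gcongr
      _ = _ := by field_simp; ring
  · rw [integral_sub htr (integrable_const _)]
    simp only [integral_const, probReal_univ, one_smul]
    -- The loss gap is nonnegative by `hIf` and is dropped from `hkey`.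
    refine le_of_mul_le_mul_left (a := lam ^ 2 / 2) ?_ hl2
    linarith

/-- The parameters and the accuracy scale polynomially in the dimension. -/
lemma exists_complexity_constant (hL₁ : 0 < L₁) (hL₂ : 0 < L₂) (hL₃ : 0 < L₃) (R ε₀ : ℝ) :
    ∃ C : ℝ, 0 < C ∧
      (∀ (d : ℕ) (ε lam : ℝ), 1 ≤ d → 0 < ε → lam ^ 2 = lamSq d L₁ L₂ L₃ ε →
        lam ≤ C * Real.sqrt ε / (d : ℝ) ^ 2) ∧
      (∀ (d : ℕ) (ε r : ℝ), 1 ≤ d → 0 < ε → ε ≤ ε₀ → 0 ≤ r → r ≤ R →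
        ∃ T : ℕ, 1 ≤ T ∧ (T : ℝ) ≤ C * (d : ℝ) ^ 5 / ε ^ 2 ∧ iterBound d L₁ L₂ L₃ ε r ≤ T) ∧
      (∀ (d : ℕ) (ε : ℝ), 1 ≤ d → 0 < ε → ε ≤ ε₀ →
        L₁ ^ 2 * ε / (L₂ ^ 2 * ((d : ℝ) + 8) ^ 3) * (1 + ε / (L₁ * ((d : ℝ) + 8))) ≤
          C * ε / (d : ℝ) ^ 3) := by
  -- One constant for each claim. For `d ≥ 1`, `d + 2 ≤ 3d`, `d + 4 ≤ 5d` and `d + 8 ≤ 9d` produce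
  -- `144 = 48 · 3`, `25` and `6561 = 9⁴`; the summand `2ε₀²` absorbs the rounding of `T`, and
  -- `|ε₀|` keeps `C₃` positive for every real `ε₀`.
  set C₁ := Real.sqrt (2 * L₁) / L₂ with hC₁
  set C₂ := 144 * L₁ * R ^ 2 * (25 * L₃ / 2 + 6561 * L₂ ^ 2 / (2 * L₁)) + 2 * ε₀ ^ 2 with hC₂
  set C₃ := L₁ ^ 2 / L₂ ^ 2 * (1 + |ε₀| / L₁) with hC₃
  have p₁ : 0 < C₁ := by positivity
  have p₂ : 0 ≤ C₂ := by positivity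
  have p₃ : 0 < C₃ := by positivity
  refine ⟨C₁ + C₂ + C₃, by positivity, ?_, ?_, ?_⟩
  · intro d ε lam hd hε hlam
    have hd0 : (0 : ℝ) < d := by exact_mod_cast hd
    have hb : lam ^ 2 ≤ 2 * L₁ * ε / (L₂ ^ 2 * ((d : ℝ) + 8) ^ 4) :=
      hlam.trans_le (min_le_right _ _)
    have h₁ : lam ≤ C₁ * Real.sqrt ε / (d : ℝ) ^ 2 := by
      refine (abs_le_of_sq_le_sq' ?_ (by positivity)).2
      calc lam ^ 2 ≤ _ := hb
        _ ≤ 2 * L₁ * ε / (L₂ ^ 2 * (d : ℝ) ^ 4) := by gcongr; linarith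
        _ = _ := by
          rw [hC₁, div_pow, mul_pow, div_pow, Real.sq_sqrt hε.le, Real.sq_sqrt (by positivity)]
          field_simp
    refine h₁.trans ?_
    gcongr
    linarith
  · intro d ε r hd hε hε₀ hr hR
    have hd1 : (1 : ℝ) ≤ d := by exact_mod_cast hd
    have hb0 : 0 ≤ iterBound d L₁ L₂ L₃ ε r := by unfold iterBound; positivity
    -- The extra `1` ensures `T ≥ 1` when the bound is `0`, as for `r = 0`.
    refine ⟨⌈iterBound d L₁ L₂ L₃ ε r⌉₊ + 1, by omega, ?_, ?_⟩
    · have hceil := (Nat.ceil_lt_add_one hb0).le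
      have hit : iterBound d L₁ L₂ L₃ ε r ≤
          144 * L₁ * R ^ 2 * (25 * L₃ / 2 + 6561 * L₂ ^ 2 / (2 * L₁)) * (d : ℝ) ^ 5 / ε ^ 2 := by
        unfold iterBound
        have hd3 : (d : ℝ) ^ 2 ≤ d ^ 4 := pow_le_pow_right₀ hd1 (by norm_num)
        have hmax : max (L₃ * ((d : ℝ) + 4) ^ 2 / (2 * ε))
            (L₂ ^ 2 * ((d : ℝ) + 8) ^ 4 / (2 * L₁ * ε)) ≤
            (25 * L₃ / 2 + 6561 * L₂ ^ 2 / (2 * L₁)) * d ^ 4 / ε := by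
          have k₁ : L₃ * ((d : ℝ) + 4) ^ 2 / (2 * ε) ≤ 25 * L₃ / 2 * d ^ 4 / ε := by
            calc _ ≤ L₃ * (5 * (d : ℝ)) ^ 2 / (2 * ε) := by gcongr; linarith
              _ = 25 * L₃ / 2 * (d : ℝ) ^ 2 / ε := by field_simp; ring
              _ ≤ _ := by gcongr
          have k₂ : L₂ ^ 2 * ((d : ℝ) + 8) ^ 4 / (2 * L₁ * ε) ≤
              6561 * L₂ ^ 2 / (2 * L₁) * d ^ 4 / ε := by
            calc _ ≤ L₂ ^ 2 * (9 * (d : ℝ)) ^ 4 / (2 * L₁ * ε) := by gcongr; linarith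
              _ = _ := by field_simp; ring
          have q₁ : 0 ≤ 25 * L₃ / 2 * (d : ℝ) ^ 4 / ε := by positivity
          have q₂ : 0 ≤ 6561 * L₂ ^ 2 / (2 * L₁) * (d : ℝ) ^ 4 / ε := by positivity
          have e : (25 * L₃ / 2 + 6561 * L₂ ^ 2 / (2 * L₁)) * (d : ℝ) ^ 4 / ε =
            25 * L₃ / 2 * d ^ 4 / ε + 6561 * L₂ ^ 2 / (2 * L₁) * d ^ 4 / ε := by ring
          rw [e]
          exact max_le (by linarith) (by linarith)
        calc _ ≤ 48 * (3 * (d : ℝ)) * L₁ * R ^ 2 / ε *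
              ((25 * L₃ / 2 + 6561 * L₂ ^ 2 / (2 * L₁)) * d ^ 4 / ε) := by
              gcongr
              linarith
          _ = _ := by field_simp; ring
      have htwo : 2 ≤ 2 * ε₀ ^ 2 * (d : ℝ) ^ 5 / ε ^ 2 := by
        rw [le_div_iff₀ (by positivity)]
        have h₅ : (1 : ℝ) ≤ d ^ 5 := one_le_pow₀ hd1
        calc 2 * ε ^ 2 ≤ 2 * ε₀ ^ 2 := by gcongr
          _ ≤ _ := le_mul_of_one_le_right (by positivity) h₅
      have hsum : C₂ * (d : ℝ) ^ 5 / ε ^ 2 =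
          144 * L₁ * R ^ 2 * (25 * L₃ / 2 + 6561 * L₂ ^ 2 / (2 * L₁)) * (d : ℝ) ^ 5 / ε ^ 2 +
            2 * ε₀ ^ 2 * (d : ℝ) ^ 5 / ε ^ 2 := by rw [hC₂]; ring
      have hle : C₂ * (d : ℝ) ^ 5 / ε ^ 2 ≤ (C₁ + C₂ + C₃) * (d : ℝ) ^ 5 / ε ^ 2 := by
        gcongr; linarith
      push_cast
      linarith
    · push_cast
      linarith [Nat.le_ceil (iterBound d L₁ L₂ L₃ ε r)]
  · intro d ε hd hε hε₀
    have hd1 : (1 : ℝ) ≤ d := by exact_mod_cast hd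
    have h₁ : ε / (L₁ * ((d : ℝ) + 8)) ≤ |ε₀| / L₁ := by
      gcongr
      · exact hε₀.trans (le_abs_self _)
      · exact le_mul_of_one_le_right hL₁.le (by linarith)
    calc _ ≤ L₁ ^ 2 * ε / (L₂ ^ 2 * (d : ℝ) ^ 3) * (1 + |ε₀| / L₁) := by
          gcongr; linarith
      _ = C₃ * ε / (d : ℝ) ^ 3 := by rw [hC₃]; field_simp
      _ ≤ _ := by gcongr; linarith

end Main
end FlatMinima
end

theorem mainTheorem4 (L₁ L₂ L₃ : ℝ) (hL₁ : 0 < L₁) (hL₂ : 0 < L₂) (hL₃ : 0 < L₃) :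
    -- convergence of the averaged iterate on the regularized loss
    (∀ (d : ℕ) (f : FlatMinima.E d → ℝ),
      FlatMinima.SmoothnessAssumption L₁ L₂ L₃ f → ConvexOn ℝ Set.univ f →
      ∀ (lam : ℝ), 0 < lam →
      ∀ xlam ∈ FlatMinima.argmin (FlatMinima.smoothed f lam),
      ∀ (x₀ : FlatMinima.E d) (Ω : Type*) [MeasurableSpace Ω] (P : Measure Ω)
        [IsProbabilityMeasure P] (u : ℕ → Ω → FlatMinima.E d),
      FlatMinima.IsGaussianDirections P u →
      ∀ T : ℕ, 1 ≤ T →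
        BddBelow (Set.range (FlatMinima.regLoss f lam)) ∧
        Integrable (fun ω => FlatMinima.regLoss f lam
          (FlatMinima.avgIterate f (FlatMinima.stepsize d L₁) lam x₀ (fun t => u t ω) T)) P ∧
        ∫ ω, (FlatMinima.regLoss f lam
            (FlatMinima.avgIterate f (FlatMinima.stepsize d L₁) lam x₀ (fun t => u t ω) T)
              - ⨅ x, FlatMinima.regLoss f lam x) ∂P
          ≤ 8 * ((d : ℝ) + 2) * L₁ * ‖x₀ - xlam‖ ^ 2 / T
            + L₂ ^ 2 / (12 * L₁) * lam ^ 4 * ((d : ℝ) + 8) ^ 4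
            + L₃ / 12 * lam ^ 4 * ((d : ℝ) + 4) ^ 2) ∧
    -- explicit choice of `λ` and `T`
    (∀ (d : ℕ) (f : FlatMinima.E d → ℝ),
      FlatMinima.SmoothnessAssumption L₁ L₂ L₃ f → ConvexOn ℝ Set.univ f →
      (FlatMinima.argmin f).Nonempty →
      ∀ (ε lam : ℝ), 0 < ε → 0 < lam → lam ^ 2 = FlatMinima.lamSq d L₁ L₂ L₃ ε →
      ∀ xlam ∈ FlatMinima.argmin (FlatMinima.smoothed f lam),
      ∀ (x₀ : FlatMinima.E d) (Ω : Type*) [MeasurableSpace Ω] (P : Measure Ω)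
        [IsProbabilityMeasure P] (u : ℕ → Ω → FlatMinima.E d),
      FlatMinima.IsGaussianDirections P u →
      ∀ T : ℕ, 1 ≤ T → FlatMinima.iterBound d L₁ L₂ L₃ ε ‖x₀ - xlam‖ ≤ T →
        FlatMinima.IsApproxFlatMinInExpectation P f
          (L₁ ^ 2 * ε / (L₂ ^ 2 * ((d : ℝ) + 8) ^ 3) * (1 + ε / (L₁ * ((d : ℝ) + 8)))) ε
          (fun ω =>
            FlatMinima.avgIterate f (FlatMinima.stepsize d L₁) lam x₀ (fun t => u t ω) T)) ∧
    -- complexity: the constant depends only on `L₁, L₂, L₃`, on a bound for the initial distance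
    -- and on an upper limit for the accuracies considered
    (∀ R ε₀ : ℝ, ∃ C : ℝ, 0 < C ∧
      ∀ (d : ℕ) (f : FlatMinima.E d → ℝ), 1 ≤ d →
      FlatMinima.SmoothnessAssumption L₁ L₂ L₃ f → ConvexOn ℝ Set.univ f →
      (FlatMinima.argmin f).Nonempty →
      ∀ (ε lam : ℝ), 0 < ε → ε ≤ ε₀ → 0 < lam → lam ^ 2 = FlatMinima.lamSq d L₁ L₂ L₃ ε →
      ∀ xlam ∈ FlatMinima.argmin (FlatMinima.smoothed f lam),
      ∀ (x₀ : FlatMinima.E d), ‖x₀ - xlam‖ ≤ R →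
        lam ≤ C * Real.sqrt ε / (d : ℝ) ^ 2 ∧
        ∃ T : ℕ, 1 ≤ T ∧ (T : ℝ) ≤ C * (d : ℝ) ^ 5 / ε ^ 2 ∧
          ∀ (Ω : Type*) [MeasurableSpace Ω] (P : Measure Ω) [IsProbabilityMeasure P]
            (u : ℕ → Ω → FlatMinima.E d), FlatMinima.IsGaussianDirections P u →
            FlatMinima.IsApproxFlatMinInExpectation P f (C * ε / (d : ℝ) ^ 3) ε
              (fun ω =>
                FlatMinima.avgIterate f (FlatMinima.stepsize d L₁) lam x₀ (fun t => u t ω) T)) := by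
  refine ⟨?_, ?_, ?_⟩
  · intro d f hs hc lam hl z hz x₀ Ω _ P _ u hu T hT
    exact FlatMinima.regLoss_avgIterate hL₁ hL₂.le hL₃.le hs hc hl hz x₀ hu hT
  · intro d f hs hc hne ε lam hε hl hlam z hz x₀ Ω _ P _ u hu T hT hT'
    exact FlatMinima.isApproxFlatMin_avgIterate hL₁ hL₂ hL₃ hs hc hne hε hl hlam hz x₀ hu hT hT'
  · intro R ε₀
    obtain ⟨C, hC, h₁, h₂, h₃⟩ := FlatMinima.exists_complexity_constant hL₁ hL₂ hL₃ R ε₀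
    refine ⟨C, hC, fun d f hd hs hc hne ε lam hε hε₀ hl hlam z hz x₀ hR => ⟨?_, ?_⟩⟩
    · exact h₁ d ε lam hd hε hlam
    -- `T` depends on deterministic data only, so it is fixed before the probability space.
    · obtain ⟨T, hT, hTC, hTb⟩ := h₂ d ε _ hd hε hε₀ (norm_nonneg _) hR
      refine ⟨T, hT, hTC, fun Ω _ P _ u hu => ?_⟩
      have := FlatMinima.isApproxFlatMin_avgIterate hL₁ hL₂ hL₃ hs hc hne hε hl hlam hz x₀ hu hT hTb
      exact ⟨this.1, this.2.trans (h₃ d ε hd hε hε₀), this.3, this.4⟩
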